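/- Let $\beta>1$ be a Pisot number (a real algebraic integer $>1$, possibly a rational integer, all of whose other conjugates have modulus $<1$). Let $T_\beta(x)=\beta x-\lfloor\beta x\rfloor$, and let $d_\beta(x)=u_1u_2\cdots$ with $u_i=\lfloor\beta T_\beta^{i-1}(x)\rfloor$ be the $\beta$-expansion of $x\in[0,1]$. Assume property (F): $d_\beta(x)$ ends in zeros for every $x\in\mathbb Z[1/\beta]\cap[0,1)$. Notation. For real $y\ge 0$ let $\{y\}_\beta=T_\beta^p(y\beta^{-p})$, where $p\ge 0$ is the least integer with $y<\beta^p$, be its $\beta$-fractional part. Let $d^*_\beta(1)=t_1t_2\cdots$ be $(t_1\cdots t_N)^\infty$ if $d_\beta(1)=t_1\cdots t_{N-1}(t_N+1)0^\infty$, and $d_\beta(1)$ if $d_\beta(1)$ is infinite; write $d_\beta^*(1)=t_1\cdots t_m(t_{m+1}\cdots t_n)^\infty$ with minimal preperiod $m$ and minimal period $n-m$. A finite word $w$ is admissible if every shift of $w0^\infty$ is lexicographically smaller than $d^*_\beta(1)$. The admissibility graph has nodes $1,\dots,n$; from each node $b$ there are edges to $1$ labelled $0,\dots,t_b-1$ and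 one edge labelled $t_b$, leading to $b+1$ if $b<n$ and to $m+1$ if $b=n$. Let $\mathcal L^{(a)}_\beta$ be the set of admissible words that label a path from $1$ to $a$. Let $K_\infty$ be the product of the archimedean completions of $\mathbb Q(\beta)$ other than the one given by $\mathbb Q(\beta)\subset\mathbb R$, let $K_f=\prod_{\mathfrak P}K_{\mathfrak P}$ over the prime ideals $\mathfrak P\ni\beta$ of the ring of integers of $\mathbb Q(\beta)$, let $K_\beta=K_\infty\times K_f$ with the product topology and Haar measure $\mu_\beta$ of its additive group, and let $\phi_\beta:\mathbb Q(\beta)\to K_\beta$ be the diagonal embedding. Put $X=\mathbb Z[1/\beta]\cap[0,1)$. The complete $x$-tile ($x\in X$) and the complete central $a$-subtile ($1\le a\le n$) are $$\widetilde{\mathcal T}(x)=\overline{\phi_\beta(\{y\in\mathbb R_{\ge 0}:\{y\}_\beta=x\})},\qquad \widetilde{\mathcal T}^{(a)}=\overline{\phi_\beta(\{w_p\beta^p+\dots+w_0: w_p\cdots w_0\in\mathcal L_\beta^{(a)}\})}.$$ A point of a member of a family of sets is exclusive if it lies in no other member (members being distinguished by their indices). Theorem. 1. For every $x\in X$, $\widetilde{\mathcal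 T}(x)$ is the closure of its interior, all its inner points are exclusive in the family $(\widetilde{\mathcal T}(x'))_{x'\in X}$, and $\mu_\beta(\partial\widetilde{\mathcal T}(x))=0$. For $x\ne x'$ in $X$, $\widetilde{\mathcal T}(x')$ does not meet the interior of $\widetilde{\mathcal T}(x)$, and $\mu_\beta(\widetilde{\mathcal T}(x)\cap\widetilde{\mathcal T}(x'))=0$. 2. For every $a\in\{1,\dots,n\}$, all the assertions of part 1 hold for the family of translates $(\widetilde{\mathcal T}^{(a)}+\phi_\beta(x))_{x\in X}$ in place of $(\widetilde{\mathcal T}(x))_{x\in X}$. 3. In the family of all translates $\widetilde{\mathcal T}^{(a)}+\phi_\beta(x)$ with $1\le a\le n$, $x\in X$ and $x<T_\beta^{a-1}(1)$, indexed by the pairs $(a,x)$, all inner points of each member are exclusive; no member meets the interior of another one, and any two different members intersect in a set of $\mu_\beta$-measure zero. -/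

import Mathlib

open MeasureTheory IntermediateField IsDedekindDomain
open scoped NumberField

noncomputable section

namespace BetaTile

/-! ### Beta-numeration -/

/-- A Pisot number: a real algebraic integer `β > 1` all of whose other conjugates have
modulus less than one. (The integers `β ≥ 2` are included.) -/
structure IsPisot (β : ℝ) : Prop where
  one_lt : 1 < β
  isIntegral : IsIntegral ℤ β
  norm_conj_lt : ∀ z : ℂ, Polynomial.aeval z (minpoly ℚ β) = 0 → z ≠ (β : ℂ) → ‖z‖ < 1

/-- The `β`-transformation `T_β : x ↦ βx mod 1`. -/
def betaMap (β x : ℝ) : ℝ := Int.fract (β * x)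

/-- The digits of the `β`-expansion `d_β(x)` of `x ∈ [0,1]`; the first digit has index `0`. -/
def digit (β x : ℝ) (i : ℕ) : ℕ := ⌊β * (betaMap β)^[i] x⌋₊

/-- `d_β(x)` is finite, i.e. it ends in zeros. -/
def HasFiniteExpansion (β x : ℝ) : Prop := ∃ N, ∀ i ≥ N, digit β x i = 0

/-- The ring `ℤ[1/β]`, as a subring of `ℝ`. -/
def zInv (β : ℝ) : Subring ℝ := (Algebra.adjoin ℤ {β⁻¹}).toSubring

/-- The finiteness property (F). -/
def FinitenessProperty (β : ℝ) : Prop :=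
  ∀ x ∈ zInv β, 0 ≤ x → x < 1 → HasFiniteExpansion β x

/-- The fractional part `{y}_β` of a real number `y ≥ 0`: if `y < β ^ p` and
`d_β(y / β ^ p) = u₁u₂⋯`, the `β`-fractional part of `y` is the number `T_β^p (y / β ^ p)`,
which has the expansion `u_{p+1}u_{p+2}⋯`. -/
def betaFract (β y : ℝ) : ℝ :=
  let p := sInf {p : ℕ | y < β ^ p}
  (betaMap β)^[p] (y / β ^ p)

open Classical in
/-- The quasi-greedy expansion `d*_β(1)`. If `d_β(1) = t₁⋯t_{N-1}(t_N + 1)0^∞` is finite, it is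
`(t₁⋯t_N)^∞`, otherwise it is `d_β(1)`. The first digit has index `0`. -/
def dStar (β : ℝ) (i : ℕ) : ℕ :=
  if HasFiniteExpansion β 1 then
    let N := sInf {N | ∀ i ≥ N, digit β 1 i = 0}
    if i % N = N - 1 then digit β 1 (N - 1) - 1 else digit β 1 (i % N)
  else digit β 1 i

/-- The digits `t₁, t₂, …` of `d*_β(1)`, numbered from one. -/
def parryDigit (β : ℝ) (a : ℕ) : ℕ := dStar β (a - 1)

/-- The length `m` of the preperiod of `d*_β(1)`. -/
def preperiod (β : ℝ) : ℕ :=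
  sInf {m | ∃ p, 1 ≤ p ∧ ∀ i ≥ m, dStar β (i + p) = dStar β i}

/-- The length of the period of `d*_β(1)`. -/
def period (β : ℝ) : ℕ :=
  sInf {p | 1 ≤ p ∧ ∀ i ≥ preperiod β, dStar β (i + p) = dStar β i}

/-- The number `n` of nodes of the admissibility graph: `d*_β(1) = t₁⋯t_m(t_{m+1}⋯t_n)^∞`.
The set `𝒜` of nodes is `{1, …, n}`. -/
def nodeCount (β : ℝ) : ℕ := preperiod β + period β

/-- A finite string `w` of digits is admissible if `w0^∞` and all its shifts are
lexicographically less than `d*_β(1)`. -/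
def Admissible (β : ℝ) (w : List ℕ) : Prop :=
  ∀ k, toLex (fun i : ℕ => w.getD (k + i) 0) < toLex (dStar β)

/-- The edges `b --ε--> a` of the admissibility graph: from the node `b` there are edges to the
node `1` with the labels `0, …, t_b - 1`, and one edge labelled `t_b`, which goes to the
node `b + 1` if `b < n` and to the node `m + 1` if `b = n`. -/
def Edge (β : ℝ) (b ε a : ℕ) : Prop :=
  (ε < parryDigit β b ∧ a = 1) ∨
    (ε = parryDigit β b ∧ a = if b = nodeCount β then preperiod β + 1 else b + 1)

/-- `Reaches β w a`: the string `w`, read from left to right, labels a path of the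
admissibility graph from the node `1` to the node `a`. -/
inductive Reaches (β : ℝ) : List ℕ → ℕ → Prop
  | nil : Reaches β [] 1
  | snoc {w : List ℕ} {b ε a : ℕ} : Reaches β w b → Edge β b ε a → Reaches β (w ++ [ε]) a

/-- The language `ℒ_β^{(a)}` of the admissible strings leading from the node `1` to `a`. -/
def language (β : ℝ) (a : ℕ) : Set (List ℕ) := {w | Admissible β w ∧ Reaches β w a}

/-- The value `w_p β^p + ⋯ + w_0` of the string `w_p ⋯ w_0`. -/
def value (β : ℝ) (w : List ℕ) : ℝ := w.foldl (fun v ε => v * β + ε) 0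

/-- The `β`-integers whose expansion belongs to `ℒ_β^{(a)}`. (Leading zeros are harmless: they
lead from the node `1` to itself, so they change neither the value nor the final node.) -/
def subInt (β : ℝ) (a : ℕ) : Set ℝ := value β '' language β a

/-! ### The complete representation space -/

/-- The field `ℚ(β)`. -/
abbrev K (β : ℝ) : Type := ℚ⟮β⟯

instance instNumberFieldK (β : ℝ) [h : Fact (IsPisot β)] : NumberField (K β) where
  to_charZero := inferInstance
  to_finiteDimensional :=
    adjoin.finiteDimensional (h.out.isIntegral.tower_top (A := ℚ))

/-- The infinite place of `ℚ(β)` given by the inclusion `ℚ(β) ⊆ ℝ`. -/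
def idPlace (β : ℝ) : NumberField.InfinitePlace (K β) :=
  .mk ((algebraMap ℝ ℂ).comp (algebraMap (K β) ℝ))

/-- `K_∞`: the product of the archimedean completions of `ℚ(β)` other than the usual one. -/
abbrev KInf (β : ℝ) : Type :=
  ∀ v : {v : NumberField.InfinitePlace (K β) // v ≠ idPlace β}, v.1.Completion

/-- The prime ideals of the ring of integers of `ℚ(β)` that contain `β`. -/
abbrev PrimesOver (β : ℝ) : Type :=
  {P : HeightOneSpectrum (𝓞 (K β)) // ∃ b ∈ P.asIdeal, ((b : K β) : ℝ) = β}

/-- `K_f`: the product of the completions `K_𝔓` over the prime ideals `𝔓` containing `β`. -/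
abbrev KFin (β : ℝ) [Fact (IsPisot β)] : Type :=
  ∀ P : PrimesOver β, P.1.adicCompletion (K β)

/-- The complete representation space `K_β = K_∞ × K_f`, with the product topology. -/
abbrev KBeta (β : ℝ) [Fact (IsPisot β)] : Type := KInf β × KFin β

instance instMeasurableSpaceKBeta (β : ℝ) [Fact (IsPisot β)] : MeasurableSpace (KBeta β) :=
  borel _

instance instBorelSpaceKBeta (β : ℝ) [Fact (IsPisot β)] : BorelSpace (KBeta β) := ⟨rfl⟩

/-- The diagonal embedding `φ_β : ℚ(β) → K_β`. -/
def phi (β : ℝ) [Fact (IsPisot β)] : K β →+* KBeta β :=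
  RingHom.prod (RingHom.pi fun v => algebraMap (K β) v.1.Completion)
    (RingHom.pi fun P => algebraMap (K β) (P.1.adicCompletion (K β)))

/-! ### Tiles -/

/-- The set `ℤ[1/β] ∩ [0,1)`, as a subset of `ℚ(β)`. -/
def tileIndex (β : ℝ) : Set (K β) := {x | (x : ℝ) ∈ zInv β ∧ 0 ≤ (x : ℝ) ∧ (x : ℝ) < 1}

/-- The complete `x`-tile: the closure of `φ_β({y ≥ 0 : {y}_β = x})`. (Since `y` and `{y}_β`
differ by an element of `ℤ[β]`, every such `y` belongs to `ℚ(β)`.) -/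
def tile (β : ℝ) [Fact (IsPisot β)] (x : K β) : Set (KBeta β) :=
  closure (phi β '' {y | 0 ≤ (y : ℝ) ∧ betaFract β y = x})

/-- The complete central `a`-subtile. -/
def subtile (β : ℝ) [Fact (IsPisot β)] (a : ℕ) : Set (KBeta β) :=
  closure (phi β '' {y | (y : ℝ) ∈ subInt β a})

/-- The translate of the complete central `a`-subtile by `φ_β(x)`. -/
def subtileAt (β : ℝ) [Fact (IsPisot β)] (a : ℕ) (x : K β) : Set (KBeta β) :=
  (fun z => z + phi β x) '' subtile β a

/-- The pairs `(a, x)` with `a ∈ {1, …, n}`, `x ∈ ℤ[1/β] ∩ [0,1)` and `x < T_β^{a-1}(1)`. For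
given `x`, these are the `a` for which `subtileAt β a x` is a part of the complete `x`-tile. -/
def subtileIndex (β : ℝ) : Set (ℕ × K β) :=
  {p | 1 ≤ p.1 ∧ p.1 ≤ nodeCount β ∧ p.2 ∈ tileIndex β ∧
    (p.2 : ℝ) < (betaMap β)^[p.1 - 1] 1}

/-- The point `z` is exclusive in the member `T i` of the family `(T j)_{j ∈ S}`. -/
def IsExclusive {ι E : Type*} (S : Set ι) (T : ι → Set E) (i : ι) (z : E) : Prop :=
  z ∈ T i ∧ ∀ j ∈ S, j ≠ i → z ∉ T j

end BetaTile

end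

/-! Every `y ≥ 0` is in exactly one way the sum of a `β`-integer with node `a` and of its fractional
part, which lies in `[0, T_β^{a-1}(1))`. So the sets of `y ∈ ℤ[1/β]`, `y ≥ 0`, with given node and
fractional part partition `ℤ[1/β]_{≥0}`, whose image `D` in `K_β` is dense by weak approximation.
Property (F), together with the discreteness of `ℤ[1/β]` in `ℝ × K_β`, makes the image of each of
these pieces relatively open in `D`. Closures of disjoint relatively open subsets of a dense set are
regular closed and do not meet each other's interiors, so everything except the statements about
measure is formal. For the latter, let `N` be the complement of the union of the interiors of all
the subtiles. The boundaries of all the tiles lie in `N`. Multiplication by `β` contracts `K_β` and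
maps each piece into another one, so it maps the complement of `N` into itself; hence `N`, which has
a hole of fixed size near every point, has holes at all small scales, and is a null set. -/

noncomputable section

namespace BetaTile

/-! ### The quasi-greedy expansion of one -/

lemma eq_zero_of_forall_pow_mul_abs_le {β x C : ℝ} (hβ : 1 < β) (h : ∀ i : ℕ, β ^ i * |x| ≤ C) :
    x = 0 := by
  by_contra hne
  have hx : 0 < |x| := abs_pos.2 hne
  obtain ⟨i, hi⟩ := pow_unbounded_of_one_lt (C / |x|) hβ
  rw [div_lt_iff₀ hx] at hi
  exact (h i).not_gt hi

/-- The orbit of `1` under the quasi-greedy transformation `x ↦ βx - (⌈βx⌉ - 1)` of `(0,1]`, which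
governs `d*_β(1)` as `T_β` governs `d_β(1)`. -/
def quasiOrbit (β : ℝ) : ℕ → ℝ
  | 0 => 1
  | i + 1 => β * quasiOrbit β i - (⌈β * quasiOrbit β i⌉ - 1 : ℤ)

/-- The digits of the quasi-greedy expansion of `1`; the first digit has index `0`. -/
def quasiDigit (β : ℝ) (i : ℕ) : ℕ := (⌈β * quasiOrbit β i⌉ - 1).toNat

lemma quasiOrbit_mem_Ioc (β : ℝ) (i : ℕ) : quasiOrbit β i ∈ Set.Ioc 0 1 := by
  cases i with
  | zero => simp [quasiOrbit]
  | succ i =>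
    have h1 := Int.le_ceil (β * quasiOrbit β i)
    have h2 := Int.ceil_lt_add_one (β * quasiOrbit β i)
    simp only [quasiOrbit, Set.mem_Ioc]
    push_cast
    constructor <;> linarith

lemma quasiOrbit_sub_quasiOrbit_le (β : ℝ) (i j : ℕ) : |quasiOrbit β i - quasiOrbit β j| ≤ 1 := by
  have hi := quasiOrbit_mem_Ioc β i
  have hj := quasiOrbit_mem_Ioc β j
  exact abs_sub_le_iff.2 ⟨by linarith [hi.2, hj.1], by linarith [hj.2, hi.1]⟩

section QuasiGreedy

variable {β : ℝ} (hβ : 1 < β)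
include hβ

lemma cast_quasiDigit (i : ℕ) : (quasiDigit β i : ℤ) = ⌈β * quasiOrbit β i⌉ - 1 := by
  have : 0 < ⌈β * quasiOrbit β i⌉ :=
    Int.ceil_pos.2 (mul_pos (by linarith) (quasiOrbit_mem_Ioc β i).1)
  simp only [quasiDigit]
  omega

lemma quasiOrbit_succ (i : ℕ) :
    quasiOrbit β (i + 1) = β * quasiOrbit β i - quasiDigit β i := by
  rw [quasiOrbit, ← cast_quasiDigit hβ, Int.cast_natCast]

lemma quasiDigit_zero_pos : 0 < quasiDigit β 0 := by
  have h := cast_quasiDigit hβ 0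
  have : 1 < ⌈β * quasiOrbit β 0⌉ := by
    rw [Int.lt_ceil]
    simpa [quasiOrbit] using hβ
  omega

lemma quasiDigit_lt (i : ℕ) : (quasiDigit β i : ℝ) < β := by
  have h := quasiOrbit_succ hβ i
  have h1 := (quasiOrbit_mem_Ioc β (i + 1)).1
  have h2 := (quasiOrbit_mem_Ioc β i).2
  nlinarith

lemma toLex_quasiDigit_shift_le (k : ℕ) :
    toLex (fun i => quasiDigit β (k + i)) ≤ toLex (quasiDigit β) := by
  refine not_lt.1 fun ⟨i, heq, hlt⟩ => ?_
  have hle : ∀ j ≤ i, quasiOrbit β (k + j) ≤ quasiOrbit β j := by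
    intro j hj
    induction j with
    | zero => exact (quasiOrbit_mem_Ioc β k).2
    | succ j ih =>
      have hdigit : quasiDigit β j = quasiDigit β (k + j) := heq j hj
      rw [← add_assoc, quasiOrbit_succ hβ, quasiOrbit_succ hβ, hdigit]
      have := ih (by omega)
      nlinarith
  have h1 := cast_quasiDigit hβ i
  have h2 := cast_quasiDigit hβ (k + i)
  have hceil : ⌈β * quasiOrbit β (k + i)⌉ ≤ ⌈β * quasiOrbit β i⌉ :=
    Int.ceil_le_ceil (mul_le_mul_of_nonneg_left (hle i le_rfl) (by linarith))
  have : quasiDigit β i < quasiDigit β (k + i) := hlt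
  omega

lemma quasiOrbit_eq_one_of_periodic {p : ℕ} (h : Function.Periodic (quasiDigit β) p) :
    quasiOrbit β p = 1 := by
  have hexpand : ∀ i, quasiOrbit β (i + p) - quasiOrbit β i = β ^ i * (quasiOrbit β p - 1) := by
    intro i
    induction i with
    | zero => simp [quasiOrbit]
    | succ i ih =>
      rw [add_right_comm, quasiOrbit_succ hβ, quasiOrbit_succ hβ, h, pow_succ]
      linear_combination β * ih
  refine sub_eq_zero.1 (eq_zero_of_forall_pow_mul_abs_le (C := 1) hβ fun i => ?_)
  rw [← abs_of_pos (pow_pos (by linarith : (0 : ℝ) < β) i), ← abs_mul, ← hexpand]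
  exact quasiOrbit_sub_quasiOrbit_le β _ _

end QuasiGreedy

/-! ### The greedy expansion -/

lemma betaMap_zero (β : ℝ) : betaMap β 0 = 0 := by simp [betaMap]

lemma betaMap_mem_Ico (β x : ℝ) : betaMap β x ∈ Set.Ico 0 1 :=
  ⟨Int.fract_nonneg _, Int.fract_lt_one _⟩

lemma betaMap_eq_mul_sub_floor {β x : ℝ} (h : 0 ≤ β * x) : betaMap β x = β * x - ⌊β * x⌋₊ := by
  rw [betaMap, ← Int.self_sub_floor, natCast_floor_eq_intCast_floor h]

lemma ceil_eq_floor_add_one_of_betaMap_ne_zero {β x : ℝ} (h : betaMap β x ≠ 0) :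
    ⌈β * x⌉ = ⌊β * x⌋ + 1 :=
  (Int.ceil_eq_floor_add_one_iff_notMem _).2 fun hm => h (Int.fract_eq_zero_iff.2 hm)

lemma betaMap_iterate_mem_Icc {β x : ℝ} (hx : x ∈ Set.Icc 0 1) (i : ℕ) :
    (betaMap β)^[i] x ∈ Set.Icc 0 1 := by
  cases i with
  | zero => exact hx
  | succ i =>
    rw [Function.iterate_succ_apply']
    exact Set.Ico_subset_Icc_self (betaMap_mem_Ico β _)

lemma betaMap_iterate_eq_zero_of_digit_eq_zero {β x : ℝ} (hβ : 1 < β) (hx : x ∈ Set.Icc 0 1) {N : ℕ}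
    (h : ∀ i ≥ N, digit β x i = 0) : (betaMap β)^[N] x = 0 := by
  have hexpand : ∀ k, (betaMap β)^[N + k] x = β ^ k * (betaMap β)^[N] x := by
    intro k
    induction k with
    | zero => simp
    | succ k ih =>
      have hdigit := h (N + k) (by omega)
      have h0 := (betaMap_iterate_mem_Icc (β := β) hx (N + k)).1
      rw [digit] at hdigit
      rw [← add_assoc, Function.iterate_succ_apply',
        betaMap_eq_mul_sub_floor (mul_nonneg (by linarith) h0), hdigit, ih, pow_succ]
      push_cast
      ring
  refine eq_zero_of_forall_pow_mul_abs_le (C := 1) hβ fun k => ?_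
  rw [abs_of_nonneg (betaMap_iterate_mem_Icc hx N).1, ← hexpand]
  exact (betaMap_iterate_mem_Icc hx _).2

lemma digit_eq_zero_of_betaMap_iterate_eq_zero {β x : ℝ} {j : ℕ} (h : (betaMap β)^[j] x = 0) :
    ∀ i ≥ j, digit β x i = 0 := by
  intro i hi
  obtain ⟨k, rfl⟩ := Nat.exists_eq_add_of_le hi
  have : (betaMap β)^[j + k] x = 0 := by
    rw [add_comm, Function.iterate_add_apply, h]
    exact Function.iterate_fixed (betaMap_zero β) k
  simp [digit, this]

/-- The length of the expansion `d_β(1)`, if this is finite (and `0` otherwise). -/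
def expLength (β : ℝ) : ℕ := sInf {N | ∀ i ≥ N, digit β 1 i = 0}

lemma betaMap_iterate_one_ne_zero {β : ℝ} {i : ℕ} (hi : i < expLength β) :
    (betaMap β)^[i] 1 ≠ 0 :=
  fun h => Nat.notMem_of_lt_sInf hi (digit_eq_zero_of_betaMap_iterate_eq_zero h)

lemma quasiOrbit_eq_betaMap_iterate {β : ℝ} {i : ℕ} (hi : i < expLength β) :
    quasiOrbit β i = (betaMap β)^[i] 1 := by
  induction i with
  | zero => rfl
  | succ i ih =>
    have h := betaMap_iterate_one_ne_zero hi
    rw [Function.iterate_succ_apply', ← ih (by omega)] at h ⊢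
    rw [quasiOrbit, ceil_eq_floor_add_one_of_betaMap_ne_zero h, add_sub_cancel_right,
      Int.self_sub_floor, betaMap]

/-! ### The admissibility graph of a finite expansion -/

/-- The end of the edge labelled `t_b` that leaves the node `b`, when `d*_β(1)` is purely
periodic. -/
def nextNode (β : ℝ) (b : ℕ) : ℕ := if b = nodeCount β then 1 else b + 1

/-- The bound of the node `a`: the numbers `0 ≤ x < T_β^{a-1}(1)` are the possible fractional
parts after a `β`-integer which ends at the node `a`. -/
def nodeBound (β : ℝ) (a : ℕ) : ℝ := quasiOrbit β (a - 1)

lemma nodeBound_one (β : ℝ) : nodeBound β 1 = 1 := rfl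

lemma nodeBound_pos (β : ℝ) (a : ℕ) : 0 < nodeBound β a := (quasiOrbit_mem_Ioc β _).1

lemma nodeBound_le_one (β : ℝ) (a : ℕ) : nodeBound β a ≤ 1 := (quasiOrbit_mem_Ioc β _).2

section FiniteExpansion

variable {β : ℝ} (hβ : 1 < β) (hfin : HasFiniteExpansion β 1)
include hβ hfin

lemma betaMap_iterate_expLength : (betaMap β)^[expLength β] 1 = 0 :=
  betaMap_iterate_eq_zero_of_digit_eq_zero hβ ⟨zero_le_one, le_rfl⟩ (Nat.sInf_mem hfin)

lemma expLength_pos : 0 < expLength β := by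
  rw [Nat.pos_iff_ne_zero]
  intro h
  have := betaMap_iterate_expLength hβ hfin
  simp [h] at this

lemma exists_mul_quasiOrbit_eq_intCast {i : ℕ} (hi : i + 1 = expLength β) :
    ∃ z : ℤ, (z : ℝ) = β * quasiOrbit β i := by
  have h := betaMap_iterate_expLength hβ hfin
  rw [← hi, Function.iterate_succ_apply', ← quasiOrbit_eq_betaMap_iterate (by omega)] at h
  exact Int.fract_eq_zero_iff.1 h

lemma quasiOrbit_expLength : quasiOrbit β (expLength β) = 1 := by
  obtain ⟨i, hi⟩ := Nat.exists_eq_add_of_le' (expLength_pos hβ hfin)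
  obtain ⟨z, hz⟩ := exists_mul_quasiOrbit_eq_intCast hβ hfin hi.symm
  rw [hi, quasiOrbit, ← hz]
  simp

lemma quasiOrbit_periodic : Function.Periodic (quasiOrbit β) (expLength β) := by
  intro i
  induction i with
  | zero => rw [zero_add, quasiOrbit_expLength hβ hfin]; rfl
  | succ i ih => rw [add_right_comm, quasiOrbit, ih, quasiOrbit]

lemma quasiDigit_periodic : Function.Periodic (quasiDigit β) (expLength β) := fun i => by
  simp only [quasiDigit, quasiOrbit_periodic hβ hfin i]

lemma quasiDigit_eq_of_lt_expLength {i : ℕ} (hi : i < expLength β) :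
    quasiDigit β i = if i = expLength β - 1 then digit β 1 i - 1 else digit β 1 i := by
  have hq := cast_quasiDigit hβ i
  have hd : (digit β 1 i : ℤ) = ⌊β * quasiOrbit β i⌋ := by
    rw [digit, ← quasiOrbit_eq_betaMap_iterate hi]
    exact Int.natCast_floor_eq_floor
      (mul_nonneg (by linarith) (quasiOrbit_mem_Ioc β i).1.le)
  split_ifs with hlast
  · obtain ⟨z, hz⟩ := exists_mul_quasiOrbit_eq_intCast hβ hfin (i := i) (by omega)
    rw [← hz, Int.ceil_intCast] at hq
    rw [← hz, Int.floor_intCast] at hd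
    omega
  · have h := betaMap_iterate_one_ne_zero (β := β) (i := i + 1) (by omega)
    rw [Function.iterate_succ_apply', ← quasiOrbit_eq_betaMap_iterate hi] at h
    rw [ceil_eq_floor_add_one_of_betaMap_ne_zero h] at hq
    omega

lemma dStar_eq_quasiDigit : dStar β = quasiDigit β := by
  funext i
  rw [← (quasiDigit_periodic hβ hfin).map_mod_nat,
    quasiDigit_eq_of_lt_expLength hβ hfin (Nat.mod_lt _ (expLength_pos hβ hfin)), dStar,
    if_pos hfin]
  change (if i % expLength β = expLength β - 1 then digit β 1 (expLength β - 1) - 1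
    else digit β 1 (i % expLength β)) = _
  split_ifs with h
  · rw [h]
  · rfl

lemma dStar_periodic : Function.Periodic (dStar β) (expLength β) := by
  rw [dStar_eq_quasiDigit hβ hfin]
  exact quasiDigit_periodic hβ hfin

lemma preperiod_eq_zero : preperiod β = 0 :=
  Nat.sInf_eq_zero.2
    (Or.inl ⟨expLength β, expLength_pos hβ hfin, fun i _ => dStar_periodic hβ hfin i⟩)

lemma nodeCount_eq_expLength : nodeCount β = expLength β := by
  rw [nodeCount, preperiod_eq_zero hβ hfin, zero_add, period, preperiod_eq_zero hβ hfin]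
  have hmem : expLength β ∈ {p | 1 ≤ p ∧ ∀ i ≥ 0, dStar β (i + p) = dStar β i} :=
    ⟨expLength_pos hβ hfin, fun i _ => dStar_periodic hβ hfin i⟩
  refine le_antisymm (Nat.sInf_le hmem) (le_csInf ⟨_, hmem⟩ ?_)
  rintro p ⟨hp, h⟩
  by_contra! hlt
  obtain ⟨k, rfl⟩ := Nat.exists_eq_add_of_le' hp
  have hone : quasiOrbit β (k + 1) = 1 := quasiOrbit_eq_one_of_periodic hβ fun i => by
    rw [← dStar_eq_quasiDigit hβ hfin, h i (Nat.zero_le _)]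
  rw [quasiOrbit_eq_betaMap_iterate hlt, Function.iterate_succ_apply'] at hone
  exact (betaMap_mem_Ico β _).2.ne hone

lemma nodeCount_pos : 0 < nodeCount β :=
  nodeCount_eq_expLength hβ hfin ▸ expLength_pos hβ hfin

lemma parryDigit_eq_quasiDigit (b : ℕ) : parryDigit β b = quasiDigit β (b - 1) := by
  rw [parryDigit, dStar_eq_quasiDigit hβ hfin]

lemma parryDigit_one_pos : 0 < parryDigit β 1 := by
  rw [parryDigit_eq_quasiDigit hβ hfin]
  exact quasiDigit_zero_pos hβ

lemma parryDigit_lt (b : ℕ) : (parryDigit β b : ℝ) < β := by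
  rw [parryDigit_eq_quasiDigit hβ hfin]
  exact quasiDigit_lt hβ _

lemma nodeBound_eq_betaMap_iterate {a : ℕ} (ha : a ∈ Set.Icc 1 (nodeCount β)) :
    nodeBound β a = (betaMap β)^[a - 1] 1 := by
  rw [nodeCount_eq_expLength hβ hfin] at ha
  exact quasiOrbit_eq_betaMap_iterate (by have := ha.1; have := ha.2; omega)

lemma nodeBound_nextNode {b : ℕ} (hb : 1 ≤ b) :
    nodeBound β (nextNode β b) = β * nodeBound β b - parryDigit β b := by
  rw [parryDigit_eq_quasiDigit hβ hfin, nodeBound, nodeBound, ← quasiOrbit_succ hβ,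
    Nat.sub_add_cancel hb, nextNode, nodeCount_eq_expLength hβ hfin]
  split_ifs with h
  · rw [h, quasiOrbit_expLength hβ hfin]; rfl
  · rfl

lemma edge_iff {b ε a : ℕ} : Edge β b ε a ↔
    (ε < parryDigit β b ∧ a = 1) ∨ (ε = parryDigit β b ∧ a = nextNode β b) := by
  rw [Edge, preperiod_eq_zero hβ hfin, nextNode]

lemma label_le_of_edge {b ε a : ℕ} (h : Edge β b ε a) : ε ≤ parryDigit β b := by
  rcases (edge_iff hβ hfin).1 h with ⟨h, -⟩ | ⟨h, -⟩
  exacts [h.le, h.le]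

omit hβ hfin in
lemma edge_target_unique {b ε a a' : ℕ} (h : Edge β b ε a) (h' : Edge β b ε a') : a = a' := by
  rcases h with ⟨h1, h2⟩ | ⟨h1, h2⟩ <;> rcases h' with ⟨h3, h4⟩ | ⟨h3, h4⟩ <;> omega

lemma edge_target_mem_Icc {b ε a : ℕ} (hb : b ≤ nodeCount β) (h : Edge β b ε a) :
    a ∈ Set.Icc 1 (nodeCount β) := by
  have hpos := nodeCount_pos hβ hfin
  rcases (edge_iff hβ hfin).1 h with ⟨-, rfl⟩ | ⟨-, rfl⟩
  · exact ⟨le_rfl, hpos⟩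
  · rw [nextNode, Set.mem_Icc]
    split_ifs <;> omega

lemma reaches_mem_Icc {w : List ℕ} {a : ℕ} (h : Reaches β w a) :
    a ∈ Set.Icc 1 (nodeCount β) := by
  induction h with
  | nil => exact ⟨le_rfl, nodeCount_pos hβ hfin⟩
  | snoc _ he ih => exact edge_target_mem_Icc hβ hfin ih.2 he

end FiniteExpansion

/-- The sequence `w₀ ⋯ w_p s₀ s₁ ⋯`. -/
def prepend : List ℕ → (ℕ → ℕ) → ℕ → ℕ
  | [], s, i => s i
  | ε :: _, _, 0 => ε
  | _ :: w, s, i + 1 => prepend w s i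

lemma prepend_nil (s : ℕ → ℕ) : prepend [] s = s := rfl

lemma prepend_append (w v : List ℕ) (s : ℕ → ℕ) :
    prepend (w ++ v) s = prepend w (prepend v s) := by
  funext i
  induction w generalizing i with
  | nil => rfl
  | cons ε w ih =>
    cases i with
    | zero => rfl
    | succ i => exact ih i

lemma prepend_zero (w : List ℕ) (i : ℕ) : prepend w (fun _ => 0) i = w.getD i 0 := by
  induction w generalizing i with
  | nil => rfl
  | cons ε w ih =>
    cases i with
    | zero => rfl
    | succ i => simpa [prepend] using ih i

lemma toLex_prepend_singleton_lt {ε : ℕ} {s u : ℕ → ℕ}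
    (h : ε < u 0 ∨ (ε = u 0 ∧ toLex s < toLex fun i => u (i + 1))) :
    toLex (prepend [ε] s) < toLex u := by
  rcases h with h | ⟨h, i, hi, hlt⟩
  · exact ⟨0, by simp, h⟩
  · refine ⟨i + 1, fun j hj => ?_, hlt⟩
    cases j with
    | zero => exact h
    | succ j => exact hi j (by omega)

section Admissible

variable {β : ℝ} (hβ : 1 < β) (hfin : HasFiniteExpansion β 1)
include hβ hfin

lemma quasiDigit_nextNode {b : ℕ} (hb : 1 ≤ b) (i : ℕ) :
    quasiDigit β (nextNode β b - 1 + i) = quasiDigit β (b - 1 + (i + 1)) := by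
  have : b - 1 + (i + 1) = b + i := by omega
  rw [this, nextNode, nodeCount_eq_expLength hβ hfin]
  split_ifs with h
  · rw [h, add_comm (expLength β), quasiDigit_periodic hβ hfin]; simp
  · rfl

lemma toLex_prepend_lt_of_reaches {w : List ℕ} {a : ℕ} (h : Reaches β w a) {s : ℕ → ℕ}
    (hs : toLex s < toLex fun i => quasiDigit β (a - 1 + i)) {v : List ℕ} (hv : v <:+ w) :
    toLex (prepend v s) < toLex (quasiDigit β) := by
  induction h generalizing s v with
  | nil =>
    rw [List.suffix_nil.1 hv]
    simpa [prepend_nil] using hs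
  | @snoc w b ε a hr he ih =>
    rcases List.suffix_concat_iff.1 hv with rfl | ⟨t, rfl, hvt⟩
    · exact hs.trans_le (toLex_quasiDigit_shift_le hβ _)
    · rw [prepend_append]
      refine ih (toLex_prepend_singleton_lt ?_) hvt
      rcases (edge_iff hβ hfin).1 he with ⟨hlt, rfl⟩ | ⟨heq, rfl⟩
      · exact Or.inl (parryDigit_eq_quasiDigit hβ hfin b ▸ hlt)
      · refine Or.inr ⟨parryDigit_eq_quasiDigit hβ hfin b ▸ heq, ?_⟩
        simpa only [quasiDigit_nextNode hβ hfin (reaches_mem_Icc hβ hfin hr).1] using hs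

lemma toLex_zero_lt_quasiDigit_shift (k : ℕ) :
    toLex (fun _ : ℕ => 0) < toLex fun i => quasiDigit β (k + i) := by
  refine Pi.toLex_strictMono (Pi.lt_def.2 ⟨fun _ => Nat.zero_le _, k * expLength β - k, ?_⟩)
  have hle : k ≤ k * expLength β := Nat.le_mul_of_pos_right k (expLength_pos hβ hfin)
  have hper := (quasiDigit_periodic hβ hfin).nat_mul_eq k
  rw [Nat.cast_id] at hper
  rw [Nat.add_sub_cancel' hle, hper]
  exact quasiDigit_zero_pos hβ

lemma admissible_of_reaches {w : List ℕ} {a : ℕ} (h : Reaches β w a) : Admissible β w := by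
  intro k
  have hzeros : (fun i => w.getD (k + i) 0) = prepend (w.drop k) fun _ => 0 := by
    funext i
    rw [prepend_zero]
    simp [List.getD_eq_getElem?_getD]
  rw [dStar_eq_quasiDigit hβ hfin, hzeros]
  exact toLex_prepend_lt_of_reaches hβ hfin h (toLex_zero_lt_quasiDigit_shift hβ hfin _)
    (List.drop_suffix _ _)

lemma mem_subInt {y : ℝ} {a : ℕ} : y ∈ subInt β a ↔ ∃ w, Reaches β w a ∧ value β w = y :=
  ⟨fun ⟨w, hw, e⟩ => ⟨w, hw.2, e⟩,
    fun ⟨w, hw, e⟩ => ⟨w, ⟨admissible_of_reaches hβ hfin hw, hw⟩, e⟩⟩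

end Admissible

/-! ### Values of strings and fractional parts -/

lemma value_nil (β : ℝ) : value β [] = 0 := rfl

lemma value_snoc (β : ℝ) (w : List ℕ) (ε : ℕ) : value β (w ++ [ε]) = value β w * β + ε := by
  simp [value]

lemma value_append (β : ℝ) (w v : List ℕ) :
    value β (w ++ v) = value β w * β ^ v.length + value β v := by
  induction v using List.reverseRecOn with
  | nil => simp [value_nil]
  | append_singleton v ε ih =>
    rw [← List.append_assoc, value_snoc, value_snoc, ih, List.length_append, List.length_singleton,
      pow_succ]
    ring

lemma value_replicate_zero (β : ℝ) (k : ℕ) : value β (List.replicate k 0) = 0 := by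
  induction k with
  | zero => rfl
  | succ k ih => rw [List.replicate_succ', value_snoc, ih]; simp

lemma value_nonneg {β : ℝ} (hβ : 0 ≤ β) (w : List ℕ) : 0 ≤ value β w := by
  induction w using List.reverseRecOn with
  | nil => exact le_rfl
  | append_singleton w ε ih => rw [value_snoc]; positivity

lemma div_pow_mem_Ico {β y : ℝ} (hβ : 0 < β) (h0 : 0 ≤ y) {p : ℕ} (hp : y < β ^ p) :
    y / β ^ p ∈ Set.Ico 0 1 :=
  ⟨by positivity, by rwa [div_lt_one (by positivity)]⟩

lemma betaMap_iterate_div_pow {β y : ℝ} (hβ : 1 < β) (h0 : 0 ≤ y) {p q : ℕ} (hp : y < β ^ p)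
    (hpq : p ≤ q) : (betaMap β)^[q] (y / β ^ q) = (betaMap β)^[p] (y / β ^ p) := by
  induction q, hpq using Nat.le_induction with
  | base => rfl
  | succ q hq ih =>
    have hβ0 : 0 < β := by linarith
    have hmul : β * (y / β ^ (q + 1)) = y / β ^ q := by
      rw [pow_succ]
      field_simp
    have hlt : y < β ^ q := hp.trans_le (pow_le_pow_right₀ hβ.le hq)
    rw [Function.iterate_succ_apply, betaMap, hmul,
      Int.fract_eq_self.2 (div_pow_mem_Ico hβ0 h0 hlt), ih]

lemma betaFract_eq {β y : ℝ} (hβ : 1 < β) (h0 : 0 ≤ y) {p : ℕ} (hp : y < β ^ p) :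
    betaFract β y = (betaMap β)^[p] (y / β ^ p) :=
  (betaMap_iterate_div_pow hβ h0 (Nat.sInf_mem (s := {p : ℕ | y < β ^ p}) ⟨p, hp⟩)
    (Nat.sInf_le hp)).symm

lemma betaFract_mul_pow {β y : ℝ} (hβ : 1 < β) (h0 : 0 ≤ y) (k : ℕ) :
    betaFract β (y * β ^ k) = (betaMap β)^[k] (betaFract β y) := by
  have hβ0 : 0 < β := by linarith
  obtain ⟨p, hp⟩ := pow_unbounded_of_one_lt y hβ
  have hlt : y * β ^ k < β ^ (k + p) := by
    rw [pow_add, mul_comm]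
    gcongr
  rw [betaFract_eq hβ (by positivity) hlt, betaFract_eq hβ h0 hp, Function.iterate_add_apply,
    pow_add, mul_comm y, mul_div_mul_left _ _ (pow_pos hβ0 k).ne']

/-! ### Expansions of non-negative reals -/

section Expansion

variable {β : ℝ} (hβ : 1 < β) (hfin : HasFiniteExpansion β 1)
include hβ hfin

lemma exists_edge_floor {b : ℕ} (hb : 1 ≤ b) {x : ℝ} (hx : x ∈ Set.Ico 0 (nodeBound β b)) :
    ∃ a, Edge β b ⌊β * x⌋₊ a ∧ betaMap β x < nodeBound β a := by
  have hβ0 : 0 < β := by linarith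
  have hx0 : 0 ≤ β * x := mul_nonneg hβ0.le hx.1
  have hnext := nodeBound_nextNode hβ hfin hb
  have hlt : β * x < β * nodeBound β b := mul_lt_mul_of_pos_left hx.2 hβ0
  rcases lt_or_ge ⌊β * x⌋₊ (parryDigit β b) with h | h
  · exact ⟨1, (edge_iff hβ hfin).2 (Or.inl ⟨h, rfl⟩), (betaMap_mem_Ico β x).2⟩
  · have hle : ⌊β * x⌋₊ < parryDigit β b + 1 := by
      have h1 := nodeBound_le_one β (nextNode β b)
      have h2 := Nat.floor_le hx0
      have : (⌊β * x⌋₊ : ℝ) < parryDigit β b + 1 := by linarith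
      exact_mod_cast this
    have heq : ⌊β * x⌋₊ = parryDigit β b := by omega
    refine ⟨_, (edge_iff hβ hfin).2 (Or.inr ⟨heq, rfl⟩), ?_⟩
    rw [hnext, betaMap_eq_mul_sub_floor hx0, heq]
    linarith

lemma add_div_mem_Ico_of_edge {b ε a : ℕ} (hb : 1 ≤ b) (he : Edge β b ε a) {x : ℝ}
    (hx : x ∈ Set.Ico 0 (nodeBound β a)) : (ε + x) / β ∈ Set.Ico 0 (nodeBound β b) := by
  have hβ0 : 0 < β := by linarith
  have hnext := nodeBound_nextNode hβ hfin hb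
  obtain ⟨hx0, hx1⟩ := hx
  refine ⟨by positivity, ?_⟩
  rw [div_lt_iff₀ hβ0, mul_comm]
  rcases (edge_iff hβ hfin).1 he with ⟨h, rfl⟩ | ⟨rfl, rfl⟩
  · have h1 := nodeBound_pos β (nextNode β b)
    have h2 : (ε : ℝ) + 1 ≤ parryDigit β b := by exact_mod_cast h
    rw [nodeBound_one] at hx1
    linarith
  · linarith

lemma exists_reaches_mul_pow_eq {x : ℝ} (hx : x ∈ Set.Ico 0 1) (k : ℕ) :
    ∃ w a, Reaches β w a ∧ x * β ^ k = value β w + (betaMap β)^[k] x ∧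
      (betaMap β)^[k] x ∈ Set.Ico 0 (nodeBound β a) := by
  induction k with
  | zero => exact ⟨[], 1, Reaches.nil, by simp [value_nil], hx⟩
  | succ k ih =>
    obtain ⟨w, b, hw, hv, hb⟩ := ih
    obtain ⟨a, he, ha⟩ := exists_edge_floor hβ hfin (reaches_mem_Icc hβ hfin hw).1 hb
    rw [Function.iterate_succ_apply']
    refine ⟨_, a, Reaches.snoc hw he, ?_, (betaMap_mem_Ico β _).1, ha⟩
    rw [value_snoc, betaMap_eq_mul_sub_floor (mul_nonneg (by linarith) hb.1), pow_succ,
      ← mul_assoc, hv]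
    ring

lemma exists_subInt_add_betaFract {u : ℝ} (h0 : 0 ≤ u) : ∃ a ∈ Set.Icc 1 (nodeCount β),
    ∃ y ∈ subInt β a, u = y + betaFract β u ∧ betaFract β u ∈ Set.Ico 0 (nodeBound β a) := by
  have hβ0 : 0 < β := by linarith
  obtain ⟨p, hp⟩ := pow_unbounded_of_one_lt u hβ
  obtain ⟨w, a, hw, hv, ha⟩ := exists_reaches_mul_pow_eq hβ hfin (div_pow_mem_Ico hβ0 h0 hp) p
  rw [div_mul_cancel₀ _ (by positivity)] at hv
  rw [betaFract_eq hβ h0 hp]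
  exact ⟨a, reaches_mem_Icc hβ hfin hw, _, (mem_subInt hβ hfin).2 ⟨w, hw, rfl⟩, hv, ha⟩

lemma reaches_unique {w : List ℕ} {a : ℕ} (h : Reaches β w a) {w' : List ℕ} {a' : ℕ}
    (h' : Reaches β w' a') (hl : w.length = w'.length) {x x' : ℝ}
    (hx : x ∈ Set.Ico 0 (nodeBound β a)) (hx' : x' ∈ Set.Ico 0 (nodeBound β a'))
    (hv : value β w + x = value β w' + x') : w = w' ∧ a = a' ∧ x = x' := by
  induction h generalizing w' a' x x' with
  | nil =>
    cases h' with
    | nil => exact ⟨rfl, rfl, by simpa using hv⟩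
    | snoc => simp at hl
  | @snoc v b ε a hr he ih =>
    cases h' with
    | nil => simp at hl
    | @snoc v' b' ε' _ hr' he' =>
      have hβ0 : β ≠ 0 := by linarith
      rw [value_snoc, value_snoc] at hv
      obtain ⟨rfl, rfl, hdiv⟩ := ih hr' (by simpa using hl)
        (add_div_mem_Ico_of_edge hβ hfin (reaches_mem_Icc hβ hfin hr).1 he hx)
        (add_div_mem_Ico_of_edge hβ hfin (reaches_mem_Icc hβ hfin hr').1 he' hx') (by
          field_simp
          linarith)
      rw [div_left_inj' hβ0] at hdiv
      have hlabel : ∀ {i j c c' : ℕ} {y z : ℝ}, y ∈ Set.Ico 0 (nodeBound β c) →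
          z ∈ Set.Ico 0 (nodeBound β c') → (i : ℝ) + y = j + z → i ≤ j := by
        intro i j c c' y z hy hz h
        have := hz.2.trans_le (nodeBound_le_one β c')
        have : (i : ℝ) < j + 1 := by linarith [hy.1]
        exact Nat.lt_succ_iff.1 (by exact_mod_cast this)
      obtain rfl := le_antisymm (hlabel hx hx' hdiv) (hlabel hx' hx hdiv.symm)
      exact ⟨rfl, edge_target_unique he he', by simpa using hdiv⟩

omit hβ hfin in
lemma reaches_append {v w : List ℕ} {a : ℕ} (hv : Reaches β v 1) (hw : Reaches β w a) :
    Reaches β (v ++ w) a := by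
  induction hw with
  | nil => simpa using hv
  | snoc _ he ih => rw [← List.append_assoc]; exact Reaches.snoc ih he

lemma edge_one_zero_one : Edge β 1 0 1 :=
  (edge_iff hβ hfin).2 (Or.inl ⟨parryDigit_one_pos hβ hfin, rfl⟩)

lemma reaches_replicate_zero (k : ℕ) : Reaches β (List.replicate k 0) 1 := by
  induction k with
  | zero => exact Reaches.nil
  | succ k ih =>
    rw [List.replicate_succ']
    exact Reaches.snoc ih (edge_one_zero_one hβ hfin)

lemma exists_reaches_of_length_le {w : List ℕ} {a : ℕ} (hw : Reaches β w a) {k : ℕ}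
    (hk : w.length ≤ k) : ∃ v, Reaches β v a ∧ value β v = value β w ∧ v.length = k :=
  ⟨List.replicate (k - w.length) 0 ++ w, reaches_append (reaches_replicate_zero hβ hfin _) hw,
    by simp [value_append, value_replicate_zero], by simpa using Nat.sub_add_cancel hk⟩

lemma exists_reaches_length_eq {y y' : ℝ} {a a' : ℕ} (hy : y ∈ subInt β a)
    (hy' : y' ∈ subInt β a') : ∃ w w', Reaches β w a ∧ Reaches β w' a' ∧
      w.length = w'.length ∧ value β w = y ∧ value β w' = y' := by
  obtain ⟨w, hw, rfl⟩ := (mem_subInt hβ hfin).1 hy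
  obtain ⟨w', hw', rfl⟩ := (mem_subInt hβ hfin).1 hy'
  obtain ⟨v, hv, e, hl⟩ := exists_reaches_of_length_le hβ hfin hw (le_max_left _ w'.length)
  obtain ⟨v', hv', e', hl'⟩ := exists_reaches_of_length_le hβ hfin hw' (le_max_right w.length _)
  exact ⟨v, v', hv, hv', hl.trans hl'.symm, e, e'⟩

lemma subInt_add_unique {y y' x x' : ℝ} {a a' : ℕ} (hy : y ∈ subInt β a)
    (hy' : y' ∈ subInt β a') (hx : x ∈ Set.Ico 0 (nodeBound β a))
    (hx' : x' ∈ Set.Ico 0 (nodeBound β a')) (h : y + x = y' + x') : a = a' ∧ x = x' := by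
  obtain ⟨w, w', hw, hw', hl, rfl, rfl⟩ := exists_reaches_length_eq hβ hfin hy hy'
  exact (reaches_unique hβ hfin hw hw' hl hx hx' h).2

omit hfin in
lemma subInt_nonneg {y : ℝ} {a : ℕ} (hy : y ∈ subInt β a) : 0 ≤ y := by
  obtain ⟨w, -, rfl⟩ := hy
  exact value_nonneg (by linarith) w

lemma betaFract_subInt_add {y x : ℝ} {a : ℕ} (hy : y ∈ subInt β a)
    (hx : x ∈ Set.Ico 0 (nodeBound β a)) : betaFract β (y + x) = x := by
  obtain ⟨a', -, y', hy', h, hx'⟩ :=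
    exists_subInt_add_betaFract hβ hfin (add_nonneg (subInt_nonneg hβ hy) hx.1)
  exact (subInt_add_unique hβ hfin hy' hy hx' hx h.symm).2

lemma value_le_of_reaches_one {w w' : List ℕ} (h : Reaches β w 1) (h' : Reaches β w' 1)
    (hl : w.length = w'.length) (hv : value β w - value β w' < 1) : value β w ≤ value β w' := by
  rcases le_total (value β w) (value β w') with hle | hle
  · exact hle
  · have hzero : (0 : ℝ) ∈ Set.Ico 0 (nodeBound β 1) := ⟨le_rfl, nodeBound_pos β 1⟩
    have hsub : value β w - value β w' ∈ Set.Ico 0 (nodeBound β 1) := ⟨sub_nonneg.2 hle, hv⟩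
    rw [(reaches_unique hβ hfin h h' hl hzero hsub (by ring)).1]

lemma value_eq_of_abs_sub_lt_one {w : List ℕ} {a : ℕ} (h : Reaches β w a) {w' : List ℕ}
    (h' : Reaches β w' a) (hl : w.length = w'.length)
    (hv : |value β w - value β w'| < 1) : value β w = value β w' := by
  have hone : ∀ {w w' : List ℕ}, Reaches β w 1 → Reaches β w' 1 → w.length = w'.length →
      |value β w - value β w'| < 1 → value β w = value β w' := fun h h' hl hv =>
    (value_le_of_reaches_one hβ hfin h h' hl (abs_sub_lt_iff.1 hv).1).antisymm
      (value_le_of_reaches_one hβ hfin h' h hl.symm (abs_sub_lt_iff.1 hv).2)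
  induction h generalizing w' with
  | nil => exact hone Reaches.nil h' hl hv
  | @snoc v b ε a hr he ih =>
    by_cases ha : a = 1
    · subst ha
      exact hone (Reaches.snoc hr he) h' hl hv
    cases h' with
    | nil => simp at hl
    | @snoc v' b' ε' _ hr' he' =>
      -- A node other than `1` has only one ingoing edge.
      obtain ⟨rfl, rfl⟩ : b = b' ∧ ε = ε' := by
        have e := (edge_iff hβ hfin).1 he
        have e' := (edge_iff hβ hfin).1 he'
        obtain rfl : b = b' := by
          rw [nextNode] at e e'
          split_ifs at e e' <;> omega
        omega
      rw [value_snoc, value_snoc] at hv ⊢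
      have hβ0 : 0 < β := by linarith
      rw [add_sub_add_right_eq_sub, ← sub_mul, abs_mul, abs_of_pos hβ0] at hv
      rw [ih hr' (by simpa using hl) (by nlinarith [abs_nonneg (value β v - value β v')])]

lemma subInt_translate_unique {y y' x x' : ℝ} {a : ℕ} (hy : y ∈ subInt β a)
    (hy' : y' ∈ subInt β a) (hx : x ∈ Set.Ico 0 1) (hx' : x' ∈ Set.Ico 0 1)
    (h : y + x = y' + x') : x = x' := by
  obtain ⟨w, w', hw, hw', hl, rfl, rfl⟩ := exists_reaches_length_eq hβ hfin hy hy'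
  have hv : |value β w - value β w'| < 1 :=
    abs_sub_lt_iff.2 ⟨by linarith [hx.1, hx'.2], by linarith [hx'.1, hx.2]⟩
  linarith [value_eq_of_abs_sub_lt_one hβ hfin hw hw' hl hv]

lemma exists_mul_subInt_add_eq {x : ℝ} {b : ℕ} (hb : b ∈ Set.Icc 1 (nodeCount β))
    (hx : x ∈ Set.Ico 0 (nodeBound β b)) : ∃ a ∈ Set.Icc 1 (nodeCount β),
      betaMap β x < nodeBound β a ∧
      ∀ y ∈ subInt β b, ∃ y' ∈ subInt β a, β * (y + x) = y' + betaMap β x := by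
  obtain ⟨a, he, ha⟩ := exists_edge_floor hβ hfin hb.1 hx
  refine ⟨a, edge_target_mem_Icc hβ hfin hb.2 he, ha, fun y hy => ?_⟩
  obtain ⟨w, hw, rfl⟩ := (mem_subInt hβ hfin).1 hy
  refine ⟨_, (mem_subInt hβ hfin).2 ⟨_, Reaches.snoc hw he, rfl⟩, ?_⟩
  rw [value_snoc, betaMap_eq_mul_sub_floor (mul_nonneg (by linarith) hx.1)]
  ring

lemma edge_zero_one_or_succ (b : ℕ) : Edge β b 0 1 ∨ Edge β b 0 (b + 1) := by
  rcases Nat.eq_zero_or_pos (parryDigit β b) with h | h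
  · have he : Edge β b 0 (nextNode β b) := (edge_iff hβ hfin).2 (Or.inr ⟨h.symm, rfl⟩)
    rw [nextNode] at he
    split_ifs at he
    exacts [Or.inl he, Or.inr he]
  · exact Or.inl ((edge_iff hβ hfin).2 (Or.inl ⟨h, rfl⟩))

lemma reaches_append_replicate_zero {w : List ℕ} {b : ℕ} (hw : Reaches β w b) (k : ℕ) :
    Reaches β (w ++ List.replicate k 0) 1 ∨ Reaches β (w ++ List.replicate k 0) (b + k) := by
  induction k with
  | zero => right; simpa using hw
  | succ k ih =>
    rw [List.replicate_succ', ← List.append_assoc, ← add_assoc]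
    rcases ih with h | h
    · exact Or.inl (Reaches.snoc h (edge_one_zero_one hβ hfin))
    · exact (edge_zero_one_or_succ hβ hfin (b + k)).imp (Reaches.snoc h) (Reaches.snoc h)

lemma reaches_append_replicate_nodeCount {w : List ℕ} {b : ℕ} (hw : Reaches β w b) :
    Reaches β (w ++ List.replicate (nodeCount β) 0) 1 := by
  refine (reaches_append_replicate_zero hβ hfin hw (nodeCount β)).resolve_right fun h => ?_
  have := (reaches_mem_Icc hβ hfin h).2
  have := (reaches_mem_Icc hβ hfin hw).1
  omega

lemma exists_forall_mul_pow_add_mem_subInt {y : ℝ} {a : ℕ} (hy : y ∈ subInt β a) :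
    ∃ k : ℕ, ∀ b, ∀ v ∈ subInt β b, v * β ^ k + y ∈ subInt β a := by
  obtain ⟨w, hw, rfl⟩ := (mem_subInt hβ hfin).1 hy
  refine ⟨nodeCount β + w.length, fun b v hv => ?_⟩
  obtain ⟨w', hw', rfl⟩ := (mem_subInt hβ hfin).1 hv
  refine (mem_subInt hβ hfin).2
    ⟨_, reaches_append (reaches_append_replicate_nodeCount hβ hfin hw') hw, ?_⟩
  rw [value_append, value_append, value_replicate_zero, List.length_replicate, pow_add]
  ring

lemma zero_mem_subInt_one : (0 : ℝ) ∈ subInt β 1 :=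
  (mem_subInt hβ hfin).2 ⟨[], Reaches.nil, rfl⟩

lemma subInt_induction {p : ℝ → Prop} (h0 : p 0)
    (hs : ∀ v, p v → ∀ ε : ℕ, (ε : ℝ) < β → p (v * β + ε)) {y : ℝ} {a : ℕ}
    (hy : y ∈ subInt β a) : p y := by
  obtain ⟨w, hw, rfl⟩ := (mem_subInt hβ hfin).1 hy
  clear hy
  induction hw with
  | nil => exact h0
  | snoc _ he ih =>
    rw [value_snoc]
    exact hs _ ih _ ((Nat.cast_le.2 (label_le_of_edge hβ hfin he)).trans_lt
      (parryDigit_lt hβ hfin _))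

lemma exists_mul_pow_mem_subInt {u : ℝ} (h0 : 0 ≤ u) {L : ℕ}
    (hL : ∀ i ≥ L, digit β (betaFract β u) i = 0) : ∃ a, u * β ^ L ∈ subInt β a := by
  have hβ0 : 0 < β := by linarith
  obtain ⟨b, -, -, -, -, hx⟩ := exists_subInt_add_betaFract hβ hfin h0
  have hx1 := hx.2.le.trans (nodeBound_le_one β b)
  obtain ⟨a, -, y, hy, h, -⟩ :=
    exists_subInt_add_betaFract hβ hfin (mul_nonneg h0 (pow_pos hβ0 L).le)
  rw [betaFract_mul_pow hβ h0,
    betaMap_iterate_eq_zero_of_digit_eq_zero hβ ⟨hx.1, hx1⟩ hL, add_zero] at h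
  exact ⟨a, h ▸ hy⟩

end Expansion

/-! ### The ring `ℤ[1/β]` -/

open Polynomial in
lemma mem_adjoin_inv_of_isIntegral {R F : Type*} [CommRing R] [Field F] [Algebra R F] {x : F}
    (hx : IsIntegral R x) : x ∈ Algebra.adjoin R {x⁻¹} := by
  rcases eq_or_ne x 0 with rfl | h0
  · exact zero_mem _
  obtain ⟨p, hp, hroot⟩ := hx
  -- The reversed polynomial has the root `x⁻¹` and the constant coefficient `1`.
  have hrev : aeval x⁻¹ p.reverse = 0 := by
    let := invertibleOfNonzero h0
    rwa [← invOf_eq_inv, aeval_def, eval₂_reverse_eq_zero_iff]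
  rw [← divX_mul_X_add p.reverse, coeff_zero_reverse, hp.leadingCoeff, map_one, map_add, map_mul,
    aeval_X, map_one, add_eq_zero_iff_eq_neg, mul_inv_eq_iff_eq_mul₀ h0, neg_one_mul] at hrev
  have hx : x = -aeval x⁻¹ p.reverse.divX := neg_eq_iff_eq_neg.1 hrev.symm
  exact Set.mem_of_eq_of_mem hx (neg_mem (aeval_mem_adjoin_singleton R _))

section Ring

variable {β : ℝ}

lemma inv_mem_zInv : β⁻¹ ∈ zInv β := Algebra.subset_adjoin (Set.mem_singleton _)

lemma self_mem_zInv (hint : IsIntegral ℤ β) : β ∈ zInv β := mem_adjoin_inv_of_isIntegral hint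

lemma betaMap_mem_zInv (hint : IsIntegral ℤ β) {x : ℝ} (hx : x ∈ zInv β) :
    betaMap β x ∈ zInv β :=
  sub_mem (mul_mem (self_mem_zInv hint) hx) (intCast_mem _ _)

lemma hasFiniteExpansion_one (hint : IsIntegral ℤ β) (hF : FinitenessProperty β) :
    HasFiniteExpansion β 1 := by
  have hmem := betaMap_mem_Ico β 1
  obtain ⟨N, hN⟩ := hF (betaMap β 1) (betaMap_mem_zInv hint (one_mem _)) hmem.1 hmem.2
  refine ⟨N + 1, fun i hi => ?_⟩
  obtain ⟨j, rfl⟩ := Nat.exists_eq_add_of_le' (Nat.one_le_of_lt hi)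
  have := hN j (by omega)
  rwa [digit, ← Function.iterate_succ_apply] at this

lemma subInt_subset_zInv (hβ : 1 < β) (hfin : HasFiniteExpansion β 1) (hint : IsIntegral ℤ β)
    (a : ℕ) : subInt β a ⊆ zInv β := fun _ =>
  subInt_induction hβ hfin (p := (· ∈ zInv β)) (zero_mem _)
    (fun _ hv ε _ => add_mem (mul_mem hv (self_mem_zInv hint)) (natCast_mem _ ε))

end Ring

/-! ### Completions of number fields are proper -/

section Completion

open NumberField NumberField.HeightOneSpectrum

variable {F : Type*} [Field F] [NumberField F] (P : HeightOneSpectrum (𝓞 F))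

lemma norm_algebraMap_adicCompletion (x : F) :
    ‖algebraMap F (P.adicCompletion F) x‖ = adicAbv F P x :=
  FinitePlace.norm_embedding P x

lemma adicAbv_lt_iff {x y : F} :
    adicAbv F P x < adicAbv F P y ↔ P.valuation F x < P.valuation F y := by
  rw [adicAbv_def, adicAbv_def, NNReal.coe_lt_coe]
  exact (WithZeroMulInt.toNNReal_strictMono (one_lt_absNorm_nnreal P)).lt_iff_lt

lemma adicAbv_le_one_iff {x : F} : adicAbv F P x ≤ 1 ↔ P.valuation F x ≤ 1 := by
  simpa only [map_one, not_lt] using (adicAbv_lt_iff P (x := 1) (y := x)).not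

lemma exists_ringOfIntegers_adicAbv_lt {ε : ℝ} (hε : 0 < ε) :
    ∃ c : 𝓞 F, c ≠ 0 ∧ adicAbv F P (c : F) < ε := by
  obtain ⟨c, hc, hc0⟩ := Submodule.exists_mem_ne_zero_of_ne_bot P.ne_bot
  have hlt : adicAbv F P (c : F) < 1 := by
    rw [← norm_algebraMap_adicCompletion]
    exact (FinitePlace.norm_lt_one_iff_mem F P c).2 hc
  obtain ⟨n, hn⟩ := exists_pow_lt_of_lt_one hε hlt
  exact ⟨c ^ n, pow_ne_zero n hc0, by simpa using hn⟩

lemma exists_ringOfIntegers_norm_sub_lt {z : P.adicCompletion F} (hz : ‖z‖ ≤ 1) {c : F}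
    (hc0 : c ≠ 0) (hc1 : adicAbv F P c ≤ 1) :
    ∃ a : 𝓞 F, ‖z - algebraMap F (P.adicCompletion F) a‖ < adicAbv F P c := by
  obtain ⟨k, hk⟩ := (HeightOneSpectrum.denseRange_algebraMap F P).exists_dist_lt z
    ((adicAbv F P).pos hc0)
  rw [dist_eq_norm] at hk
  have hk1 : P.valuation F k ≤ 1 := by
    rw [← adicAbv_le_one_iff, ← norm_algebraMap_adicCompletion]
    have hmax := IsUltrametricDist.norm_add_le_max z (algebraMap F (P.adicCompletion F) k - z)
    rw [add_sub_cancel, norm_sub_rev] at hmax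
    exact hmax.trans (max_le hz (hk.le.trans hc1))
  obtain ⟨a, ha⟩ := P.exists_valuation_sub_lt_of_integer hk1
    (Units.mk0 (P.valuation F c) (by simpa using hc0))
  have ha' : ‖algebraMap F (P.adicCompletion F) (k - a)‖ < adicAbv F P c := by
    rw [norm_algebraMap_adicCompletion, AbsoluteValue.map_sub]
    exact (adicAbv_lt_iff P).2 ha
  refine ⟨a, ?_⟩
  have hmax := IsUltrametricDist.norm_add_le_max (z - algebraMap F (P.adicCompletion F) k)
    (algebraMap F (P.adicCompletion F) (k - a))
  rw [map_sub, sub_add_sub_cancel, ← map_sub] at hmax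
  exact hmax.trans_lt (max_lt hk ha')

lemma totallyBounded_closedBall_adicCompletion :
    TotallyBounded (Metric.closedBall (0 : P.adicCompletion F) 1) := by
  rw [Metric.totallyBounded_iff]
  intro ε hε
  obtain ⟨c, hc0, hc⟩ := exists_ringOfIntegers_adicAbv_lt P (lt_min one_pos hε)
  obtain ⟨hc1, hcε⟩ := lt_min_iff.1 hc
  have : Finite (𝓞 F ⧸ Ideal.span {c}) :=
    Ideal.finiteQuotientOfFreeOfNeBot _ (by simpa using hc0)
  let rep (q : 𝓞 F ⧸ Ideal.span {c}) : P.adicCompletion F :=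
    algebraMap F (P.adicCompletion F) (Quotient.out q : 𝓞 F)
  refine ⟨Set.range rep, Set.finite_range rep, fun z hz => ?_⟩
  rw [mem_closedBall_zero_iff] at hz
  obtain ⟨a, ha⟩ := exists_ringOfIntegers_norm_sub_lt P hz
    (RingOfIntegers.coe_ne_zero_iff.2 hc0) hc1.le
  have hrep : ‖algebraMap F (P.adicCompletion F) a - rep (Ideal.Quotient.mk _ a)‖ ≤
      adicAbv F P (c : F) := by
    obtain ⟨r, hr⟩ := Ideal.mem_span_singleton'.1 (Ideal.Quotient.eq.1
      (Ideal.Quotient.mk_out (Ideal.Quotient.mk (Ideal.span {c}) a)))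
    have hr' : ((Quotient.out (Ideal.Quotient.mk (Ideal.span {c}) a) : 𝓞 F) : F) - a = r * c := by
      exact_mod_cast congrArg (algebraMap (𝓞 F) F) hr.symm
    rw [← map_sub, norm_algebraMap_adicCompletion, AbsoluteValue.map_sub, hr', map_mul]
    refine mul_le_of_le_one_left (apply_nonneg _ _) ?_
    rw [← norm_algebraMap_adicCompletion]
    exact FinitePlace.norm_le_one F P r
  refine Set.mem_iUnion₂.2 ⟨_, ⟨Ideal.Quotient.mk _ a, rfl⟩, ?_⟩
  have hmax := IsUltrametricDist.norm_add_le_max (z - algebraMap F (P.adicCompletion F) a)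
    (algebraMap F (P.adicCompletion F) a - rep (Ideal.Quotient.mk _ a))
  rw [sub_add_sub_cancel] at hmax
  rw [Metric.mem_ball, dist_eq_norm]
  exact hmax.trans_lt ((max_le ha.le hrep).trans_lt hcε)

lemma properSpace_adicCompletion : ProperSpace (P.adicCompletion F) := by
  have hcompact : IsCompact (Metric.closedBall (0 : P.adicCompletion F) 1) :=
    (totallyBounded_closedBall_adicCompletion P).isCompact_of_isClosed Metric.isClosed_closedBall
  have := hcompact.locallyCompactSpace_of_mem_nhds_of_addGroup
    (Metric.closedBall_mem_nhds 0 one_pos)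
  obtain ⟨c, hc0, hc⟩ := exists_ringOfIntegers_adicAbv_lt P one_pos
  let _ : NontriviallyNormedField (P.adicCompletion F) :=
    .ofNormNeOne ⟨algebraMap F (P.adicCompletion F) c,
      (map_ne_zero _).2 (RingOfIntegers.coe_ne_zero_iff.2 hc0), by
        rw [norm_algebraMap_adicCompletion]; exact hc.ne⟩
  exact .of_nontriviallyNormedField_of_weaklyLocallyCompactSpace (P.adicCompletion F)

omit [NumberField F] in
lemma properSpace_infinitePlace_completion (v : InfinitePlace F) : ProperSpace v.Completion := by
  have h := InfinitePlace.Completion.isometry_extensionEmbedding v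
  refine ⟨fun x r => ?_⟩
  rw [← h.preimage_closedBall]
  exact h.isClosedEmbedding.isCompact_preimage (isCompact_closedBall _ _)

end Completion

/-! ### Tilings by closures of relatively open sets -/

section Tiling

variable {ι E : Type*} [TopologicalSpace E] {D A B : Set E}

/-- `A` is relatively open in `D`, i.e. the trace on `D` of an open set. -/
def IsOpenIn (D A : Set E) : Prop := ∃ U, IsOpen U ∧ U ∩ D = A

lemma isOpenIn_iff_forall_mem :
    IsOpenIn D A ↔ A ⊆ D ∧ ∀ a ∈ A, ∃ U, IsOpen U ∧ a ∈ U ∧ U ∩ D ⊆ A := by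
  constructor
  · rintro ⟨U, hU, rfl⟩
    exact ⟨Set.inter_subset_right, fun a ha => ⟨U, hU, ha.1, subset_rfl⟩⟩
  · rintro ⟨hAD, hA⟩
    choose! U hU haU hUA using hA
    refine ⟨⋃ a ∈ A, U a, isOpen_biUnion hU, subset_antisymm ?_ fun a ha =>
      ⟨Set.mem_biUnion ha (haU a ha), hAD ha⟩⟩
    rw [Set.iUnion₂_inter]
    exact Set.iUnion₂_subset hUA

lemma IsOpenIn.iUnion {A : ι → Set E} (hA : ∀ i, IsOpenIn D (A i)) : IsOpenIn D (⋃ i, A i) := by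
  choose U hU hUA using hA
  exact ⟨⋃ i, U i, isOpen_iUnion hU, by rw [Set.iUnion_inter, Set.iUnion_congr hUA]⟩

lemma IsOpenIn.subset_interior_closure (hA : IsOpenIn D A) (hD : Dense D) :
    A ⊆ interior (closure A) := by
  obtain ⟨U, hU, rfl⟩ := hA
  exact Set.inter_subset_left.trans
    (interior_maximal (hD.open_subset_closure_inter hU) hU)

lemma IsOpenIn.closure_interior_closure (hA : IsOpenIn D A) (hD : Dense D) :
    closure (interior (closure A)) = closure A :=
  (closure_minimal interior_subset isClosed_closure).antisymm
    (closure_mono (hA.subset_interior_closure hD))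

lemma IsOpenIn.disjoint_closure_interior_closure (hB : IsOpenIn D B) (hA : A ⊆ D)
    (hBA : Disjoint B A) : Disjoint (closure B) (interior (closure A)) := by
  obtain ⟨V, hV, rfl⟩ := hB
  have hVA : Disjoint V A :=
    Set.disjoint_left.2 fun z hzV hzA => Set.disjoint_left.1 hBA ⟨hzV, hA hzA⟩ hzA
  have hVint : Disjoint V (interior (closure A)) :=
    (hVA.closure_right hV).mono_right interior_subset
  exact (hVint.closure_left isOpen_interior).mono_left (closure_mono Set.inter_subset_left)

lemma IsOpenIn.frontier_closure_subset {I : Set ι} {B : ι → Set E} (hA : IsOpenIn D A)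
    (hB : ∀ i ∈ I, B i ⊆ D) (h : ∀ i ∈ I, B i ⊆ A ∨ Disjoint A (B i)) :
    frontier (closure A) ⊆ (⋃ i ∈ I, interior (closure (B i)))ᶜ := by
  intro z hz hzB
  obtain ⟨i, hi, hzi⟩ := Set.mem_iUnion₂.1 hzB
  rw [isClosed_closure.frontier_eq] at hz
  rcases h i hi with hBA | hAB
  · exact hz.2 (interior_mono (closure_mono hBA) hzi)
  · exact Set.disjoint_left.1 (hA.disjoint_closure_interior_closure (hB i hi) hAB) hz.1 hzi

/-- The family `(T i)_{i ∈ I}` consists of closures of open sets with `μ`-null boundaries, and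
distinct members overlap neither topologically nor in measure. -/
def IsPacking [MeasurableSpace E] (μ : Measure E) (I : Set ι) (T : ι → Set E) : Prop :=
  (∀ i ∈ I, T i = closure (interior (T i)) ∧ (∀ z ∈ interior (T i), IsExclusive I T i z) ∧
    μ (frontier (T i)) = 0) ∧
  ∀ i ∈ I, ∀ j ∈ I, i ≠ j → Disjoint (T j) (interior (T i)) ∧ μ (T i ∩ T j) = 0

lemma isPacking_closure [MeasurableSpace E] {μ : Measure E} {I : Set ι} {A : ι → Set E}
    (hD : Dense D) (hA : ∀ i ∈ I, IsOpenIn D (A i)) (hdisj : I.PairwiseDisjoint A)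
    (hμ : ∀ i ∈ I, μ (frontier (closure (A i))) = 0) :
    IsPacking μ I fun i => closure (A i) := by
  have hint : ∀ i ∈ I, ∀ j ∈ I, i ≠ j →
      Disjoint (closure (A j)) (interior (closure (A i))) := fun i hi j hj hij =>
    (hA j hj).disjoint_closure_interior_closure (isOpenIn_iff_forall_mem.1 (hA i hi)).1
      (hdisj hj hi hij.symm)
  refine ⟨fun i hi => ⟨((hA i hi).closure_interior_closure hD).symm, fun z hz =>
    ⟨interior_subset hz, fun j hj hji hzj => ?_⟩, hμ i hi⟩, fun i hi j hj hij =>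
    ⟨hint i hi j hj hij, measure_mono_null (fun z hz => ?_) (hμ i hi)⟩⟩
  · exact Set.disjoint_left.1 (hint i hi j hj hji.symm) hzj hz
  · rw [isClosed_closure.frontier_eq]
    exact ⟨hz.1, Set.disjoint_left.1 (hint i hi j hj hij) hz.2⟩

end Tiling

/-! ### Porous sets are null sets -/

section Averaging

open scoped Topology Pointwise ENNReal

variable {G : Type*} [AddCommGroup G] [MeasurableSpace G] (μ : Measure G)

lemma lintegral_measure_inter_translate [MeasurableAdd₂ G] [MeasurableNeg G] [SFinite μ]
    [μ.IsAddLeftInvariant] [μ.IsNegInvariant] {S A : Set G} (hS : MeasurableSet S)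
    (hA : MeasurableSet A) : ∫⁻ w, μ (S ∩ {z | z - w ∈ A}) ∂μ = μ S * μ A := by
  let Q : Set (G × G) := {q | q.2 ∈ S ∧ q.2 - q.1 ∈ A}
  have hQ : MeasurableSet Q :=
    (measurable_snd hS).inter ((measurable_snd.sub measurable_fst) hA)
  have hfiber (z : G) : μ ((fun w => (w, z)) ⁻¹' Q) = S.indicator (fun _ => μ A) z := by
    by_cases hz : z ∈ S
    · rw [Set.indicator_of_mem hz,
        ← (Measure.measurePreserving_sub_left μ z).measure_preimage hA.nullMeasurableSet]
      congr 1
      ext w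
      simp only [Q, Set.mem_preimage, Set.mem_ofPred_eq, hz, true_and]
    · rw [Set.indicator_of_notMem hz]
      convert measure_empty (μ := μ)
      ext w
      simp only [Q, Set.mem_preimage, Set.mem_ofPred_eq, hz, false_and, Set.mem_empty_iff_false]
  calc ∫⁻ w, μ (S ∩ {z | z - w ∈ A}) ∂μ = μ.prod μ Q := (Measure.prod_apply hQ).symm
    _ = ∫⁻ z, μ ((fun w => (w, z)) ⁻¹' Q) ∂μ := Measure.prod_apply_symm hQ
    _ = μ S * μ A := by simp_rw [hfiber, lintegral_indicator_const hS, mul_comm]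

variable {μ} [TopologicalSpace G] [IsTopologicalAddGroup G] [LocallyCompactSpace G]
  [SecondCountableTopology G] [BorelSpace G] [μ.IsAddHaarMeasure]

lemma measure_le_mul_measure_of_isCompact {F O : Set G} (hF : IsCompact F) (hFm : MeasurableSet F)
    (hO : IsOpen O) (hFO : F ⊆ O) {θ : ℝ≥0∞}
    (h : ∀ V ∈ 𝓝 (0 : G), ∃ A ⊆ V, MeasurableSet A ∧ μ A ≠ 0 ∧ μ A ≠ ∞ ∧
      ∀ w, μ (F ∩ {z | z - w ∈ A}) ≤ θ * μ A) : μ F ≤ θ * μ O := by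
  obtain ⟨V, hV, hFV⟩ := compact_open_separated_add_right hF hO hFO
  obtain ⟨A, hAV, hA, hA0, hAtop, hθ⟩ := h (-V) (neg_mem_nhds_zero G hV)
  have hsupp (w : G) : μ (F ∩ {z | z - w ∈ A}) ≤ O.indicator (fun _ => θ * μ A) w := by
    by_cases hw : w ∈ O
    · rw [Set.indicator_of_mem hw]
      exact hθ w
    · rw [Set.indicator_of_notMem hw, nonpos_iff_eq_zero]
      refine measure_mono_null (fun z hz => hw (hFV ⟨z, hz.1, -(z - w), hAV hz.2, ?_⟩))
        measure_empty
      simp only [neg_sub, add_sub_cancel]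
  rw [← ENNReal.mul_le_mul_iff_left hA0 hAtop]
  calc μ F * μ A = ∫⁻ w, μ (F ∩ {z | z - w ∈ A}) ∂μ :=
        (lintegral_measure_inter_translate μ hFm hA).symm
    _ ≤ ∫⁻ w, O.indicator (fun _ => θ * μ A) w ∂μ := lintegral_mono hsupp
    _ = θ * μ O * μ A := by rw [lintegral_indicator_const hO.measurableSet]; ring

lemma measure_eq_zero_of_measure_inter_translate_le [T2Space G] {N : Set G}
    (hN : MeasurableSet N) {θ : ℝ≥0∞} (hθ : θ < 1)
    (h : ∀ V ∈ 𝓝 (0 : G), ∃ A ⊆ V, MeasurableSet A ∧ μ A ≠ 0 ∧ μ A ≠ ∞ ∧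
      ∀ w, μ (N ∩ {z | z - w ∈ A}) ≤ θ * μ A) : μ N = 0 := by
  by_contra hne
  obtain ⟨F, hFN, hF, hFpos⟩ := hN.exists_lt_isCompact (pos_iff_ne_zero.2 hne)
  have hFtop : μ F ≠ ∞ := hF.measure_lt_top.ne
  have hlt : θ * μ F < μ F := by
    simpa only [one_mul] using ENNReal.mul_lt_mul_left hFpos.ne' hFtop hθ
  obtain ⟨O, hFO, hO, hOlt⟩ := F.exists_isOpen_lt_of_lt (μ F / θ)
    ((ENNReal.lt_div_iff_mul_lt (.inr hFtop) (.inl (hθ.trans ENNReal.one_lt_top).ne)).2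
      (by rwa [mul_comm]))
  refine (measure_le_mul_measure_of_isCompact hF hF.measurableSet hO hFO fun V hV => ?_).not_gt
    (by rw [mul_comm]; exact ENNReal.mul_lt_of_lt_div hOlt)
  obtain ⟨A, hAV, hA, hA0, hAtop, hθA⟩ := h V hV
  exact ⟨A, hAV, hA, hA0, hAtop, fun w =>
    (measure_mono (Set.inter_subset_inter_left _ hFN)).trans (hθA w)⟩

end Averaging

section Porous

open scoped Topology Pointwise ENNReal

variable {E : Type*}

lemma measure_inter_closedBall_le [NormedAddCommGroup E] [ProperSpace E] [MeasurableSpace E]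
    [BorelSpace E] {μ : Measure E} [μ.IsAddHaarMeasure] {N : Set E} {w x : E} {ρ C : ℝ}
    (hx : dist w x ≤ C) (hN : Disjoint (Metric.ball x ρ) N) :
    μ (N ∩ {z | z - w ∈ Metric.closedBall 0 (C + ρ)}) ≤
      μ (Metric.closedBall 0 (C + ρ)) - μ (Metric.ball 0 ρ) := by
  have hset : {z | z - w ∈ Metric.closedBall 0 (C + ρ)} = Metric.closedBall w (C + ρ) := by
    ext z
    rw [Set.mem_ofPred_eq, mem_closedBall_zero_iff, mem_closedBall_iff_norm]
  have hball : Metric.ball x ρ ⊆ Metric.closedBall w (C + ρ) :=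
    Metric.ball_subset_closedBall.trans (Metric.closedBall_subset_closedBall' (by
      rw [dist_comm]; linarith))
  rw [hset, ← Measure.addHaar_ball_center μ x, ← Measure.addHaar_closedBall_center μ w,
    ← measure_sdiff hball Metric.isOpen_ball.measurableSet.nullMeasurableSet
      Metric.isBounded_ball.measure_lt_top.ne]
  exact measure_mono fun z hz => ⟨hz.2, fun hzx => Set.disjoint_left.1 hN hzx hz.1⟩

lemma mem_of_pow_smul_mem {M : Type*} [Monoid M] [MulAction M E] {b : M} {N : Set E}
    (hN : ∀ z, b • z ∈ N → z ∈ N) (k : ℕ) {z : E} (hz : b ^ k • z ∈ N) : z ∈ N := by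
  induction k generalizing z with
  | zero => rwa [pow_zero, one_smul] at hz
  | succ k ih =>
    rw [pow_succ, mul_smul] at hz
    exact hN z (ih hz)

lemma inter_translate_smul_subset {G : Type*} [Group G] [AddCommGroup E] [DistribMulAction G E]
    {g : G} {N A : Set E} (hN : ∀ z, g • z ∈ N → z ∈ N) (w : E) :
    N ∩ {z | z - w ∈ g • A} ⊆ g • (N ∩ {z | z - g⁻¹ • w ∈ A}) := by
  rintro z ⟨hzN, hzA⟩
  rw [Set.mem_smul_set_iff_inv_smul_mem]
  refine ⟨hN _ (by rwa [smul_inv_smul]), ?_⟩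
  rw [Set.mem_ofPred_eq, Set.mem_smul_set_iff_inv_smul_mem, smul_sub] at hzA
  exact hzA

lemma exists_pow_smul_closedBall_subset [NormedRing E] {b : Eˣ} (hb : ‖(b : E)‖ < 1) (R : ℝ)
    {V : Set E} (hV : V ∈ 𝓝 0) : ∃ k : ℕ, b ^ k • Metric.closedBall (0 : E) R ⊆ V := by
  obtain ⟨ε, hε, hεV⟩ := Metric.mem_nhds_iff.1 hV
  have hlim : Filter.Tendsto (fun k : ℕ => ‖(b : E) ^ k‖ * R) Filter.atTop (𝓝 0) := by
    simpa only [norm_zero, zero_mul] using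
      (tendsto_pow_atTop_nhds_zero_of_norm_lt_one hb).norm.mul_const R
  obtain ⟨k, hk⟩ := (hlim.eventually (gt_mem_nhds hε)).exists
  refine ⟨k, ?_⟩
  rintro _ ⟨z, hz, rfl⟩
  rw [mem_closedBall_zero_iff] at hz
  refine hεV (mem_ball_zero_iff.2 (lt_of_le_of_lt ?_ hk))
  rw [← Units.val_pow_eq_pow_val]
  exact (norm_mul_le _ _).trans (mul_le_mul_of_nonneg_left hz (norm_nonneg _))

/-- The holes of `N` at unit scale are carried to all smaller scales by the contraction `b`, so
`N` has no density point. -/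
lemma measure_eq_zero_of_porous [NormedRing E] [ProperSpace E] [MeasurableSpace E] [BorelSpace E]
    {μ : Measure E} [μ.IsAddHaarMeasure] {b : Eˣ} (hb : ‖(b : E)‖ < 1) {N : Set E} (hN : IsClosed N)
    (hbN : ∀ z, b • z ∈ N → z ∈ N) {ρ C : ℝ} (hρ : 0 < ρ)
    (hole : ∀ w, ∃ x, dist w x ≤ C ∧ Disjoint (Metric.ball x ρ) N) : μ N = 0 := by
  set A := Metric.closedBall (0 : E) (C + ρ)
  have hC : 0 ≤ C := by
    obtain ⟨x, hx, -⟩ := hole 0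
    exact dist_nonneg.trans hx
  have hA0 : μ A ≠ 0 := (Metric.measure_closedBall_pos μ 0 (by positivity)).ne'
  have hAtop : μ A ≠ ∞ := measure_closedBall_lt_top.ne
  have hball : μ (Metric.ball (0 : E) ρ) ≠ 0 := (Metric.measure_ball_pos μ 0 hρ).ne'
  set θ := (μ A - μ (Metric.ball 0 ρ)) / μ A with hθdef
  have hθA : θ * μ A = μ A - μ (Metric.ball 0 ρ) := ENNReal.div_mul_cancel hA0 hAtop
  have hθ : θ < 1 := by
    rw [hθdef, ENNReal.div_lt_iff (.inl hA0) (.inl hAtop), one_mul]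
    exact ENNReal.sub_lt_self hAtop hA0 hball
  refine measure_eq_zero_of_measure_inter_translate_le hN.measurableSet hθ fun V hV => ?_
  obtain ⟨k, hk⟩ := exists_pow_smul_closedBall_subset hb (C + ρ) hV
  have hΔ : (distribHaarChar E (b ^ k) : ℝ≥0∞) ≠ 0 :=
    ENNReal.coe_ne_zero.2 distribHaarChar_pos.ne'
  refine ⟨b ^ k • A, hk, (Metric.isClosed_closedBall.smul _).measurableSet, ?_, ?_, fun w => ?_⟩
  · rw [← distribHaarChar_mul]
    exact mul_ne_zero hΔ hA0
  · rw [← distribHaarChar_mul]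
    exact ENNReal.mul_ne_top ENNReal.coe_ne_top hAtop
  · obtain ⟨x, hx, hxN⟩ := hole ((b ^ k)⁻¹ • w)
    calc μ (N ∩ {z | z - w ∈ b ^ k • A})
        ≤ μ (b ^ k • (N ∩ {z | z - (b ^ k)⁻¹ • w ∈ A})) :=
          measure_mono <|
            inter_translate_smul_subset (fun _ => mem_of_pow_smul_mem hbN k) w
      _ = distribHaarChar E (b ^ k) * μ (N ∩ {z | z - (b ^ k)⁻¹ • w ∈ A}) :=
          (distribHaarChar_mul ..).symm
      _ ≤ distribHaarChar E (b ^ k) * (θ * μ A) := by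
          rw [hθA]
          gcongr
          exact measure_inter_closedBall_le hx hxN
      _ = θ * μ (b ^ k • A) := by rw [← distribHaarChar_mul, mul_left_comm]

end Porous

/-! ### Weak approximation -/

section WeakApproximation

open NumberField NumberField.HeightOneSpectrum

variable {F : Type*} [Field F]

lemma exists_forall_sub_lt {ι : Type*} [Finite ι] {w : ι → AbsoluteValue F ℝ}
    (hnt : ∀ i, (w i).IsNontrivial) (hpw : Pairwise fun i j => ¬ (w i).IsEquiv (w j))
    (a : ι → F) {ε : ℝ} (hε : 0 < ε) : ∃ x, ∀ i, w i (a i - x) < ε := by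
  have := Fintype.ofFinite ι
  obtain ⟨x, hx⟩ := (AbsoluteValue.denseRange_algebraMap_pi hnt hpw).exists_dist_lt
    (fun i => WithAbs.toAbs (w i) (a i)) hε
  exact ⟨x, fun i => (dist_eq_norm (E := WithAbs (w i)) _ _).symm.trans_lt
    ((dist_pi_lt_iff hε).1 hx i)⟩

lemma norm_algebraMap_completion (v : InfinitePlace F) (x : F) :
    ‖algebraMap F v.Completion x‖ = v x :=
  InfinitePlace.Completion.norm_coe v (WithAbs.toAbs v.1 x)

lemma exists_infinitePlace_norm_sub_lt {v : InfinitePlace F} (z : v.Completion) {ε : ℝ}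
    (hε : 0 < ε) :
    ∃ a : F, ∀ x, v (a - x) < ε → ‖z - algebraMap F v.Completion x‖ < ε + ε := by
  obtain ⟨a, ha⟩ := (InfinitePlace.Completion.denseRange_coe v).exists_dist_lt z hε
  refine ⟨WithAbs.equiv v.1 a, fun x hx => ?_⟩
  rw [← norm_algebraMap_completion, map_sub] at hx
  rw [dist_eq_norm] at ha
  exact norm_sub_le_norm_sub_add_norm_sub .. |>.trans_lt (add_lt_add ha hx)

variable [NumberField F]

lemma adicAbv_isNontrivial (P : HeightOneSpectrum (𝓞 F)) : (adicAbv F P).IsNontrivial := by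
  obtain ⟨c, hc, hlt⟩ := exists_ringOfIntegers_adicAbv_lt P one_pos
  exact ⟨c, RingOfIntegers.coe_ne_zero_iff.2 hc, hlt.ne⟩

lemma not_isEquiv_infinitePlace_adicAbv (v : InfinitePlace F) (P : HeightOneSpectrum (𝓞 F)) :
    ¬ v.1.IsEquiv (adicAbv F P) := fun h => by
  have harch : 1 < v.1 (2 : F) := by
    have h2 : v.1 ((2 : ℕ) : F) = 2 := v.map_natCast 2
    rw [← Nat.cast_two, h2]
    exact one_lt_two
  exact (adicAbv_natCast_le_one F P 2).not_gt (by exact_mod_cast h.one_lt_iff.1 harch)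

lemma not_isEquiv_adicAbv {P Q : HeightOneSpectrum (𝓞 F)} (hPQ : P ≠ Q) :
    ¬ (adicAbv F P).IsEquiv (adicAbv F Q) := fun h => by
  obtain ⟨x, hxP, hxQ⟩ : ∃ x ∈ P.asIdeal, x ∉ Q.asIdeal := by
    by_contra! H
    exact hPQ (HeightOneSpectrum.ext (P.isMaximal.eq_of_le Ideal.IsPrime.ne_top' H))
  have hP := (FinitePlace.norm_lt_one_iff_mem F P x).2 hxP
  have hQ := (FinitePlace.norm_eq_one_iff_notMem F Q x).2 hxQ
  rw [FinitePlace.norm_embedding] at hP hQ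
  exact (h.lt_one_iff.1 hP).ne hQ

lemma exists_adic_norm_sub_lt {P : HeightOneSpectrum (𝓞 F)} (z : P.adicCompletion F) {ε : ℝ}
    (hε : 0 < ε) :
    ∃ a : F, ∀ x, adicAbv F P (a - x) < ε →
      ‖z - algebraMap F (P.adicCompletion F) x‖ < ε + ε := by
  obtain ⟨a, ha⟩ := (HeightOneSpectrum.denseRange_algebraMap F P).exists_dist_lt z hε
  refine ⟨a, fun x hx => ?_⟩
  rw [← norm_algebraMap_adicCompletion, map_sub] at hx
  rw [dist_eq_norm] at ha
  exact norm_sub_le_norm_sub_add_norm_sub .. |>.trans_lt (add_lt_add ha hx)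

lemma denseRange_algebraMap_completions {ι κ : Type*} [Finite ι] [Finite κ]
    {v : ι → InfinitePlace F} (hv : v.Injective)
    {P : κ → HeightOneSpectrum (𝓞 F)} (hP : P.Injective) :
    DenseRange fun x : F => ((fun i => algebraMap F (v i).Completion x,
      fun j => algebraMap F ((P j).adicCompletion F) x) :
        (∀ i, (v i).Completion) × ∀ j, (P j).adicCompletion F) := by
  let w : ι ⊕ κ → AbsoluteValue F ℝ := Sum.elim (fun i => (v i).1) fun j => adicAbv F (P j)
  have hnt : ∀ s, (w s).IsNontrivial := by
    rintro (i | j)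
    exacts [(v i).isNontrivial, adicAbv_isNontrivial (P j)]
  have hpw : Pairwise fun s t => ¬ (w s).IsEquiv (w t) := by
    rintro (i | j) (i' | j') hne he
    · exact hne (congrArg _ (hv (InfinitePlace.eq_iff_isEquiv.2 he)))
    · exact not_isEquiv_infinitePlace_adicAbv _ _ he
    · exact not_isEquiv_infinitePlace_adicAbv _ _ he.symm
    · exact not_isEquiv_adicAbv (fun h => hne (congrArg _ (hP h))) he
  have := Fintype.ofFinite ι
  have := Fintype.ofFinite κ
  refine Metric.denseRange_iff.2 fun z ε hε => ?_
  choose a ha using fun i => exists_infinitePlace_norm_sub_lt (z.1 i) (half_pos hε)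
  choose b hb using fun j => exists_adic_norm_sub_lt (z.2 j) (half_pos hε)
  obtain ⟨x, hx⟩ := exists_forall_sub_lt hnt hpw (Sum.elim a b) (half_pos hε)
  simp only [add_halves] at ha hb
  refine ⟨x, ?_⟩
  rw [Prod.dist_eq, max_lt_iff, dist_pi_lt_iff hε, dist_pi_lt_iff hε]
  simp only [dist_eq_norm]
  exact ⟨fun i => ha i x (hx (Sum.inl i)), fun j => hb j x (hx (Sum.inr j))⟩

end WeakApproximation

/-! ### The representation space -/

section RepresentationSpace

open NumberField NumberField.HeightOneSpectrum

variable (β : ℝ)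

/-- The generator `β` of `ℚ(β)`. -/
def gen : K β := AdjoinSimple.gen ℚ β

@[simp] lemma coe_gen : ((gen β : K β) : ℝ) = β := AdjoinSimple.coe_gen ℚ β

/-- The ring `ℤ[1/β]`, as a subring of `ℚ(β)`. -/
def zInvK : Subring (K β) := (zInv β).comap (algebraMap (K β) ℝ)

/-- The non-negative elements of `ℤ[1/β]`, as a subset of `ℚ(β)`. -/
def zInvNonneg : Set (K β) := {u | u ∈ zInvK β ∧ 0 ≤ (u : ℝ)}

variable {β}

lemma mem_zInvK {u : K β} : u ∈ zInvK β ↔ (u : ℝ) ∈ zInv β := Iff.rfl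

lemma inv_gen_mem_zInvK : (gen β)⁻¹ ∈ zInvK β := by
  rw [mem_zInvK]
  push_cast
  rw [coe_gen]
  exact inv_mem_zInv

lemma zInvK_le {S : Subring (K β)} (h : (gen β)⁻¹ ∈ S) : zInvK β ≤ S := by
  intro u hu
  have hle : Algebra.adjoin ℤ {β⁻¹} ≤ subalgebraOfSubring (S.map (algebraMap (K β) ℝ)) := by
    rw [Algebra.adjoin_le_iff, Set.singleton_subset_iff]
    refine ⟨_, h, ?_⟩
    rw [map_inv₀]
    exact congrArg _ (coe_gen β)
  obtain ⟨v, hv, e⟩ := hle hu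
  rwa [← (algebraMap (K β) ℝ).injective e]

lemma idPlace_apply (u : K β) : idPlace β u = |(u : ℝ)| := by
  rw [idPlace, InfinitePlace.apply]
  exact Complex.norm_real _

lemma ringHom_ext_of_apply_gen {L : Type*} [Field L] [Algebra ℚ L] {σ τ : K β →+* L}
    (h : σ (gen β) = τ (gen β)) : σ = τ := by
  have hrat : σ.toRatAlgHom = τ.toRatAlgHom := adjoin_algHom_ext ℚ fun x hx => by
    obtain rfl := Set.mem_singleton_iff.1 hx
    exact h
  exact congrArg AlgHom.toRingHom hrat

lemma aeval_apply_gen_minpoly (σ : K β →+* ℂ) :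
    Polynomial.aeval (σ (gen β)) (minpoly ℚ β) = 0 := by
  rw [← minpoly_gen ℚ β]
  exact minpoly.aeval_algHom ℚ σ.toRatAlgHom (gen β)

variable (β) [hP : Fact (IsPisot β)]

lemma gen_ne_zero : gen β ≠ 0 := fun h => by
  have h0 : β = 0 := by rw [← coe_gen β, h, ZeroMemClass.coe_zero]
  linarith [hP.out.one_lt]

lemma isIntegral_gen : IsIntegral ℤ (gen β) := by
  refine (isIntegral_algebraMap_iff (algebraMap (K β) ℝ).injective).1 ?_
  exact (coe_gen β).symm ▸ hP.out.isIntegral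

lemma gen_mem_zInvK : gen β ∈ zInvK β := by
  rw [mem_zInvK, coe_gen]
  exact self_mem_zInv hP.out.isIntegral

/-- The generator `β` of `ℚ(β)` as an algebraic integer. -/
def intGen : 𝓞 (K β) := ⟨gen β, isIntegral_gen β⟩

lemma mem_primesOver_iff (P : HeightOneSpectrum (𝓞 (K β))) :
    (∃ b ∈ P.asIdeal, ((b : K β) : ℝ) = β) ↔ intGen β ∈ P.asIdeal := by
  refine ⟨fun ⟨b, hb, h⟩ => ?_, fun h => ⟨_, h, coe_gen β⟩⟩
  have hb' : b = intGen β :=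
    RingOfIntegers.coe_injective (Subtype.coe_injective (h.trans (coe_gen β).symm))
  exact hb' ▸ hb

lemma finite_primesOver : Finite (PrimesOver β) := by
  have h0 : intGen β ≠ 0 := fun h => gen_ne_zero β (congrArg Subtype.val h)
  have hfin := Ideal.finite_factors (I := Ideal.span {intGen β}) (by simpa using h0)
  refine (hfin.subset fun P hP => ?_).to_subtype
  rw [Set.mem_ofPred_eq, Ideal.dvd_span_singleton]
  exact (mem_primesOver_iff β P).1 hP

/-- The primes above `β` form a finite type. -/
abbrev fintypePrimesOver : Fintype (PrimesOver β) :=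
  have := finite_primesOver β
  Fintype.ofFinite _

/-- The infinite places other than the one given by `ℚ(β) ⊆ ℝ` form a finite type. -/
abbrev fintypePlaces : Fintype {v : InfinitePlace (K β) // v ≠ idPlace β} :=
  Fintype.ofFinite _

attribute [local instance] fintypePrimesOver fintypePlaces

/-- The maximum norm on the representation space; it induces the product topology. -/
abbrev normedCommRing : NormedCommRing (KBeta β) := inferInstance

attribute [local instance] normedCommRing

lemma properSpace : ProperSpace (KBeta β) := by
  have (P : PrimesOver β) : ProperSpace (P.1.adicCompletion (K β)) := properSpace_adicCompletion _
  have (v : {v : InfinitePlace (K β) // v ≠ idPlace β}) : ProperSpace v.1.Completion :=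
    properSpace_infinitePlace_completion _
  exact (inferInstance : ProperSpace (KInf β × KFin β))

variable {β}

lemma norm_phi_fst (u : K β) (v : {v : InfinitePlace (K β) // v ≠ idPlace β}) :
    ‖(phi β u).1 v‖ = v.1 u :=
  norm_algebraMap_completion v.1 u

lemma norm_phi_snd (u : K β) (P : PrimesOver β) : ‖(phi β u).2 P‖ = adicAbv (K β) P.1 u :=
  norm_algebraMap_adicCompletion P.1 u

lemma norm_phi_le_iff {u : K β} {C : ℝ} (hC : 0 ≤ C) : ‖phi β u‖ ≤ C ↔
    (∀ v : {v : InfinitePlace (K β) // v ≠ idPlace β}, v.1 u ≤ C) ∧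
      ∀ P : PrimesOver β, adicAbv (K β) P.1 u ≤ C := by
  simp only [Prod.norm_def, max_le_iff, pi_norm_le_iff_of_nonneg hC, norm_phi_fst, norm_phi_snd]

lemma norm_phi_lt_iff {u : K β} {C : ℝ} (hC : 0 < C) : ‖phi β u‖ < C ↔
    (∀ v : {v : InfinitePlace (K β) // v ≠ idPlace β}, v.1 u < C) ∧
      ∀ P : PrimesOver β, adicAbv (K β) P.1 u < C := by
  simp only [Prod.norm_def, max_lt_iff, pi_norm_lt_iff hC, norm_phi_fst, norm_phi_snd]

lemma place_gen_lt_one {v : InfinitePlace (K β)} (hv : v ≠ idPlace β) : v (gen β) < 1 := by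
  rw [← v.norm_embedding_eq]
  refine hP.out.norm_conj_lt _ (aeval_apply_gen_minpoly _) fun h => hv ?_
  have hemb : v.embedding = (algebraMap ℝ ℂ).comp (algebraMap (K β) ℝ) :=
    ringHom_ext_of_apply_gen (h.trans (congrArg Complex.ofReal (coe_gen β).symm))
  rw [idPlace, ← hemb, InfinitePlace.mk_embedding]

lemma adicAbv_gen_lt_one (P : PrimesOver β) : adicAbv (K β) P.1 (gen β) < 1 := by
  rw [← norm_algebraMap_adicCompletion]
  exact (FinitePlace.norm_lt_one_iff_mem (K β) P.1 (intGen β)).2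
    ((mem_primesOver_iff β P.1).1 P.2)

variable (β) in
lemma norm_phi_gen_lt_one : ‖phi β (gen β)‖ < 1 :=
  (norm_phi_lt_iff one_pos).2 ⟨fun v => place_gen_lt_one v.2, adicAbv_gen_lt_one⟩

variable (β) in
lemma tendsto_phi_gen_pow :
    Filter.Tendsto (fun k : ℕ => phi β (gen β ^ k)) Filter.atTop (nhds 0) := by
  simp only [map_pow]
  exact tendsto_pow_atTop_nhds_zero_of_norm_lt_one (norm_phi_gen_lt_one β)

lemma valuation_le_one_of_mem_zInvK {u : K β} (hu : u ∈ zInvK β)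
    {P : HeightOneSpectrum (𝓞 (K β))} (hP : intGen β ∉ P.asIdeal) :
    P.valuation (K β) u ≤ 1 := by
  refine zInvK_le (S := (P.valuation (K β)).integer) ?_ hu
  have hval : P.valuation (K β) (gen β) = 1 :=
    (P.valuation_eq_one_iff_notMem (K := K β) (r := intGen β)).2 hP
  rw [Valuation.mem_integer_iff, map_inv₀, hval, inv_one]

lemma isIntegral_of_norm_phi_le_one {u : K β} (hu : u ∈ zInvK β) (h : ‖phi β u‖ ≤ 1) :
    IsIntegral ℤ u := by
  have hval (P : HeightOneSpectrum (𝓞 (K β))) : P.valuation (K β) u ≤ 1 := by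
    by_cases hP : intGen β ∈ P.asIdeal
    · rw [← adicAbv_le_one_iff]
      exact ((norm_phi_le_iff zero_le_one).1 h).2 ⟨P, (mem_primesOver_iff β P).2 hP⟩
    · exact valuation_le_one_of_mem_zInvK hu hP
  obtain ⟨r, rfl⟩ := HeightOneSpectrum.mem_integers_of_valuation_le_one (R := 𝓞 (K β)) (K β) u hval
  exact r.2

variable (β) in
lemma finite_zInvK_norm_phi_le_one (M : ℝ) :
    {u : K β | u ∈ zInvK β ∧ |(u : ℝ)| ≤ M ∧ ‖phi β u‖ ≤ 1}.Finite := by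
  refine (Embeddings.finite_of_norm_le (K β) ℂ (max M 1)).subset ?_
  rintro u ⟨hu, hM, h1⟩
  refine ⟨isIntegral_of_norm_phi_le_one hu h1, fun σ => ?_⟩
  rw [← InfinitePlace.apply]
  by_cases hσ : InfinitePlace.mk σ = idPlace β
  · rw [hσ, idPlace_apply]
    exact hM.trans (le_max_left _ _)
  · exact (((norm_phi_le_iff zero_le_one).1 h1).1 ⟨_, hσ⟩).trans (le_max_right _ _)

variable (β) in
/-- Multiplication by a large power of `β` reduces the claim to the integral case `C = 1`. -/
lemma finite_zInvK_norm_phi_le (M C : ℝ) :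
    {u : K β | u ∈ zInvK β ∧ |(u : ℝ)| ≤ M ∧ ‖phi β u‖ ≤ C}.Finite := by
  have hlim := ((tendsto_phi_gen_pow β).norm.mul_const |C|)
  rw [norm_zero, zero_mul] at hlim
  obtain ⟨k, hk⟩ := (hlim.eventually (ge_mem_nhds one_pos)).exists
  have hinj : Function.Injective fun u : K β => gen β ^ k * u :=
    mul_right_injective₀ (pow_ne_zero _ (gen_ne_zero β))
  refine ((finite_zInvK_norm_phi_le_one β (β ^ k * M)).preimage hinj.injOn).subset ?_
  rintro u ⟨hu, hM, hC⟩
  have hβ := hP.out.one_lt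
  refine ⟨mul_mem (pow_mem (gen_mem_zInvK β) _) hu, ?_, ?_⟩
  · push_cast
    rw [coe_gen, abs_mul, abs_of_pos (by positivity)]
    gcongr
  · rw [map_mul]
    refine (norm_mul_le _ _).trans (le_trans ?_ hk)
    gcongr
    exact hC.trans (le_abs_self C)

end RepresentationSpace

/-! ### Density of `ℤ[1/β] ∩ [0, ∞)` -/

section Density

attribute [local instance] fintypePrimesOver fintypePlaces normedCommRing

lemma exists_forall_pow_add_mul_eq {M : Type*} [Monoid M] [Finite M] (x : M) :
    ∃ i q : ℕ, 0 < q ∧ ∀ m : ℕ, x ^ (i + m * q) = x ^ i := by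
  obtain ⟨i, j, hlt, hij⟩ : ∃ i j : ℕ, i < j ∧ x ^ i = x ^ j := by
    obtain ⟨i, j, hne, hij⟩ := Finite.exists_ne_map_eq_of_infinite fun i : ℕ => x ^ i
    rcases hne.lt_or_gt with h | h
    exacts [⟨i, j, h, hij⟩, ⟨j, i, h, hij.symm⟩]
  refine ⟨i, j - i, by omega, fun m => ?_⟩
  induction m with
  | zero => simp
  | succ m ih =>
    have hexp : i + (m + 1) * (j - i) = j + m * (j - i) := by
      rw [add_mul, one_mul]
      omega
    rw [hexp, pow_add, ← hij, ← pow_add, ih]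

lemma exists_forall_pow_sub_pow_eq_natCast_mul {F : Type*} [Field F] [CharZero F] {x : F}
    (hx : IsIntegral ℤ x) {d : ℕ} (hd : d ≠ 0) : ∃ i q : ℕ, 0 < q ∧ ∀ m : ℕ,
      ∃ u ∈ Algebra.adjoin ℤ {x}, x ^ i - x ^ (i + m * q) = d * u := by
  let R := Algebra.adjoin ℤ {x}
  have : Module.Finite ℤ R := Module.Finite.iff_fg.2 hx.fg_adjoin_singleton
  have : Module.Free ℤ R := Module.free_of_finite_type_torsion_free'
  have : Finite (R ⧸ Ideal.span {(d : R)}) :=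
    Ideal.finiteQuotientOfFreeOfNeBot _ (by simpa using hd)
  let g : R := ⟨x, Algebra.subset_adjoin rfl⟩
  obtain ⟨i, q, hq, h⟩ := exists_forall_pow_add_mul_eq (Ideal.Quotient.mk (Ideal.span {(d : R)}) g)
  refine ⟨i, q, hq, fun m => ?_⟩
  have hmem : g ^ i - g ^ (i + m * q) ∈ Ideal.span {(d : R)} := by
    rw [← Ideal.Quotient.eq, map_pow, map_pow]
    exact (h m).symm
  obtain ⟨r, hr⟩ := Ideal.mem_span_singleton.1 hmem
  exact ⟨r, r.2, by simpa using congrArg (algebraMap R F) hr⟩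

variable (β : ℝ) [hP : Fact (IsPisot β)]

lemma denseRange_phi : DenseRange (phi β) := by
  have := finite_primesOver β
  exact denseRange_algebraMap_completions (P := fun P : PrimesOver β => P.1)
    Subtype.val_injective Subtype.val_injective

/-- By the pigeonhole principle `β ^ i - β ^ (i + mq)` is divisible by `d` for some `i`, `q` and
all `m`, and its image tends to that of `β ^ i` as `m → ∞`. -/
lemma phi_inv_natCast_mem_closure (d : ℕ) :
    phi β (d : K β)⁻¹ ∈ ((zInvK β).map (phi β)).topologicalClosure := by
  rcases eq_or_ne d 0 with rfl | hd
  · simp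
  obtain ⟨i, q, hq, h⟩ := exists_forall_pow_sub_pow_eq_natCast_mul (isIntegral_gen β) hd
  choose u hu hm using h
  have hd' : (d : K β) ≠ 0 := Nat.cast_ne_zero.2 hd
  have hadj : Algebra.adjoin ℤ {gen β} ≤ subalgebraOfSubring (zInvK β) := by
    rw [Algebra.adjoin_le_iff, Set.singleton_subset_iff]
    exact gen_mem_zInvK β
  have hu_eq (m : ℕ) : phi β (u m) =
      phi β ((d : K β)⁻¹ * gen β ^ i) -
        phi β ((d : K β)⁻¹ * gen β ^ i) * phi β (gen β ^ (m * q)) := by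
    rw [← map_mul, ← map_sub, mul_assoc, ← pow_add, ← mul_sub, hm, inv_mul_cancel_left₀ hd']
  have hlim : Filter.Tendsto (fun m => phi β (u m)) Filter.atTop
      (nhds (phi β ((d : K β)⁻¹ * gen β ^ i))) := by
    simp only [hu_eq]
    have hpow := (tendsto_phi_gen_pow β).comp (Filter.tendsto_id.atTop_mul_const' hq)
    simpa using tendsto_const_nhds.sub (hpow.const_mul (phi β ((d : K β)⁻¹ * gen β ^ i)))
  have hmem : phi β ((d : K β)⁻¹ * gen β ^ i) ∈ ((zInvK β).map (phi β)).topologicalClosure :=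
    mem_closure_of_tendsto hlim (.of_forall fun m => ⟨u m, hadj (hu m), rfl⟩)
  have hinv : phi β ((gen β)⁻¹ ^ i) ∈ ((zInvK β).map (phi β)).topologicalClosure :=
    Subring.le_topologicalClosure _ ⟨_, pow_mem inv_gen_mem_zInvK i, rfl⟩
  rw [← mul_inv_cancel_right₀ (pow_ne_zero i (gen_ne_zero β)) (d : K β)⁻¹, map_mul, ← inv_pow]
  exact mul_mem hmem hinv

lemma phi_mem_closure (u : K β) : phi β u ∈ ((zInvK β).map (phi β)).topologicalClosure := by
  set H := ((zInvK β).map (phi β)).topologicalClosure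
  have hgen : phi β (gen β) ∈ H :=
    Subring.le_topologicalClosure _ ⟨_, gen_mem_zInvK β, rfl⟩
  have hrat (q : ℚ) : phi β (algebraMap ℚ (K β) q) ∈ H := by
    have hq : algebraMap ℚ (K β) q = (q.num : K β) * (q.den : K β)⁻¹ := by
      rw [eq_ratCast, ← div_eq_mul_inv, Rat.cast_def]
    rw [hq, map_mul, map_intCast]
    exact mul_mem (intCast_mem _ _) (phi_inv_natCast_mem_closure β _)
  have hint : IsIntegral ℚ β := hP.out.isIntegral.tower_top
  obtain ⟨f, rfl⟩ := (adjoin.powerBasis hint).exists_eq_aeval' u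
  rw [adjoin.powerBasis_gen, Polynomial.aeval_eq_sum_range, map_sum]
  refine sum_mem fun i _ => ?_
  rw [Algebra.smul_def, map_mul, map_pow]
  exact mul_mem (hrat _) (pow_mem hgen _)

lemma dense_phi_zInvK : Dense (phi β '' zInvK β) := by
  rw [dense_iff_closure_eq, ← Set.univ_subset_iff, ← (denseRange_phi β).closure_range]
  exact closure_minimal (Set.range_subset_iff.2 (phi_mem_closure β)) isClosed_closure

lemma dense_phi_zInvNonneg : Dense (phi β '' zInvNonneg β) := by
  refine (dense_phi_zInvK β).mono ?_ |>.of_closure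
  rintro _ ⟨u, hu, rfl⟩
  have hlim : Filter.Tendsto (fun k : ℕ => phi β (u + gen β ^ k)) Filter.atTop
      (nhds (phi β u)) := by
    simp only [map_add]
    simpa using (tendsto_phi_gen_pow β).const_add (phi β u)
  refine mem_closure_of_tendsto hlim ?_
  filter_upwards [(tendsto_pow_atTop_atTop_of_one_lt hP.out.one_lt).eventually_ge_atTop (-(u : ℝ))]
    with k hk
  refine ⟨_, ⟨add_mem hu (pow_mem (gen_mem_zInvK β) k), ?_⟩, rfl⟩
  push_cast
  rw [coe_gen]
  linarith

end Density

/-! ### Property (F) and relative openness -/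

/-- The translate by `x` of the `β`-integers with node `a`, for `p = (a, x)`, as a subset of
`ℚ(β)`; the closure of its image in the representation space is `subtileAt β a x`. -/
def subIntAt (β : ℝ) (p : ℕ × K β) : Set (K β) := {u | ((u - p.2 : K β) : ℝ) ∈ subInt β p.1}

lemma mem_subIntAt {β : ℝ} {p : ℕ × K β} {u : K β} :
    u ∈ subIntAt β p ↔ ((u - p.2 : K β) : ℝ) ∈ subInt β p.1 := Iff.rfl

/-- The nonnegative `y` with `β`-fractional part `x`, as a subset of `ℚ(β)`; the closure of its
image in the representation space is `tile β x`. -/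
def fractFiber (β : ℝ) (x : K β) : Set (K β) := {y | 0 ≤ (y : ℝ) ∧ betaFract β y = x}

section Finiteness

variable (β : ℝ) [hP : Fact (IsPisot β)]

attribute [local instance] fintypePrimesOver fintypePlaces normedCommRing

lemma nontrivial_KBeta : Nontrivial (KBeta β) := by
  by_contra hsub
  rw [not_nontrivial_iff_subsingleton] at hsub
  have hβ := hP.out.one_lt
  have hcoe (k : ℕ) : (((gen β)⁻¹ ^ k : K β) : ℝ) = (β ^ k)⁻¹ := by
    push_cast
    rw [coe_gen, inv_pow]
  have hinj : Function.Injective fun k : ℕ => (gen β)⁻¹ ^ k := fun i j hij => by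
    have hpow : (β ^ i)⁻¹ = (β ^ j)⁻¹ := by rw [← hcoe, ← hcoe]; exact congrArg _ hij
    exact pow_right_injective₀ (by linarith) hβ.ne' (inv_injective hpow)
  refine Set.infinite_range_of_injective hinj ((finite_zInvK_norm_phi_le β 1 0).subset ?_)
  rintro _ ⟨k, rfl⟩
  refine ⟨pow_mem inv_gen_mem_zInvK k, ?_, by simp [Subsingleton.elim (phi β _) 0]⟩
  rw [hcoe, abs_of_pos (by positivity)]
  exact inv_le_one_of_one_le₀ (one_le_pow₀ hβ.le)

lemma phi_injective : Function.Injective (phi β) :=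
  have := nontrivial_KBeta β
  (phi β).injective

lemma finite_tileIndex_norm_phi_le (C : ℝ) : {x ∈ tileIndex β | ‖phi β x‖ ≤ C}.Finite :=
  (finite_zInvK_norm_phi_le β 1 C).subset fun _ hx =>
    ⟨hx.1.1, abs_le.2 ⟨by linarith [hx.1.2.1], hx.1.2.2.le⟩, hx.2⟩

lemma exists_le_of_norm_phi_sub_lt (v : K β) :
    ∃ r > 0, ∀ u ∈ zInvNonneg β, ‖phi β u - phi β v‖ < r → (v : ℝ) ≤ u := by
  let S := {u : K β | u ∈ zInvK β ∧ |(u : ℝ)| ≤ v ∧ ‖phi β u‖ ≤ ‖phi β v‖ + 1} \ {v}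
  have hS : (phi β '' S).Finite := ((finite_zInvK_norm_phi_le β v (‖phi β v‖ + 1)).sdiff).image _
  have hv : phi β v ∈ (phi β '' S)ᶜ := by
    rintro ⟨u, hu, h⟩
    exact hu.2 (phi_injective β h)
  obtain ⟨r, hr, hball⟩ := Metric.mem_nhds_iff.1 (hS.isClosed.isOpen_compl.mem_nhds hv)
  refine ⟨min r 1, by positivity, fun u hu hlt => ?_⟩
  by_contra! huv
  refine hball (mem_ball_iff_norm.2 (hlt.trans_le (min_le_left _ _)))
    ⟨u, ⟨⟨hu.1, (abs_of_nonneg hu.2).trans_le huv.le, ?_⟩, ?_⟩, rfl⟩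
  · linarith [norm_le_norm_add_norm_sub' (phi β u) (phi β v), min_le_right r 1]
  · rintro rfl
    exact huv.false

variable {β}

lemma coe_inv_gen_pow_mul (k : ℕ) (u : K β) : (((gen β)⁻¹ ^ k * u : K β) : ℝ) * β ^ k = u := by
  have hβ : β ≠ 0 := by linarith [hP.out.one_lt]
  push_cast
  rw [coe_gen, inv_pow]
  field_simp

lemma inv_gen_pow_mul_mem_zInvNonneg {u : K β} (hu : u ∈ zInvNonneg β) (k : ℕ) :
    (gen β)⁻¹ ^ k * u ∈ zInvNonneg β := by
  have hβ := hP.out.one_lt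
  refine ⟨mul_mem (pow_mem inv_gen_mem_zInvK k) hu.1, ?_⟩
  refine nonneg_of_mul_nonneg_left (b := β ^ k) ?_ (by positivity)
  rw [coe_inv_gen_pow_mul]
  exact hu.2

lemma exists_norm_phi_mul_lt (c : K β) {r : ℝ} (hr : 0 < r) :
    ∃ δ > 0, ∀ u : K β, ‖phi β u‖ < δ → ‖phi β (c * u)‖ < r := by
  refine ⟨r / (‖phi β c‖ + 1), by positivity, fun u hu => ?_⟩
  rw [lt_div_iff₀ (by positivity)] at hu
  rw [map_mul]
  refine (norm_mul_le _ _).trans_lt ?_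
  linarith [norm_nonneg (phi β u)]

variable (hF : FinitenessProperty β)
include hF

lemma exists_forall_digit_eq_zero (C : ℝ) : ∃ L : ℕ, ∀ x ∈ tileIndex β, ‖phi β x‖ ≤ C →
    ∀ i ≥ L, digit β x i = 0 := by
  have hfin : ∀ x ∈ tileIndex β, ∃ N : ℕ, ∀ i ≥ N, digit β x i = 0 :=
    fun x hx => hF x hx.1 hx.2.1 hx.2.2
  choose! N hN using hfin
  obtain ⟨L, hL⟩ := ((finite_tileIndex_norm_phi_le β C).image N).bddAbove
  exact ⟨L, fun x hx hxC i hi => hN x hx i ((hL ⟨x, ⟨hx, hxC⟩, rfl⟩).trans hi)⟩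

lemma exists_norm_phi_subInt_le : ∃ C : ℝ, ∀ a, ∀ y ∈ subInt β a,
    ∃ y' ∈ zInvK β, (y' : ℝ) = y ∧ ‖phi β y'‖ ≤ C := by
  have hβ := hP.out.one_lt
  have hfin := hasFiniteExpansion_one hP.out.isIntegral hF
  have hρ := norm_phi_gen_lt_one β
  set ρ := ‖phi β (gen β)‖
  have hρ' : 0 < 1 - ρ := by linarith
  -- Solves `C = C * ρ + β * ‖1‖`, so that `C` bounds the Horner scheme `v ↦ v * β + ε`.
  obtain ⟨C, hC⟩ : ∃ C, C = β * ‖(1 : KBeta β)‖ / (1 - ρ) := ⟨_, rfl⟩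
  have hCρ : C * ρ + β * ‖(1 : KBeta β)‖ = C := by
    rw [hC]
    field_simp
    ring
  refine ⟨C, fun a y => subInt_induction hβ hfin
    (p := fun y => ∃ y' ∈ zInvK β, (y' : ℝ) = y ∧ ‖phi β y'‖ ≤ C)
    ⟨0, zero_mem _, by simp, ?_⟩ ?_⟩
  · rw [map_zero, norm_zero, hC]
    positivity
  · rintro v ⟨v', hv, rfl, hvC⟩ ε hε
    refine ⟨v' * gen β + ε, add_mem (mul_mem hv (gen_mem_zInvK β)) (natCast_mem _ _), ?_, ?_⟩
    · push_cast
      rw [coe_gen]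
    · rw [map_add, map_mul, map_natCast, ← hCρ]
      refine (norm_add_le _ _).trans (add_le_add ((norm_mul_le _ _).trans ?_)
        ((Nat.norm_cast_le ε).trans ?_)) <;> gcongr

lemma mem_subtileIndex {p : ℕ × K β} : p ∈ subtileIndex β ↔
    p.1 ∈ Set.Icc 1 (nodeCount β) ∧ p.2 ∈ zInvK β ∧ (p.2 : ℝ) ∈ Set.Ico 0 (nodeBound β p.1) := by
  have hβ := hP.out.one_lt
  have hfin := hasFiniteExpansion_one hP.out.isIntegral hF
  constructor
  · rintro ⟨h1, hn, ⟨hx, h0, -⟩, hlt⟩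
    rw [← nodeBound_eq_betaMap_iterate hβ hfin ⟨h1, hn⟩] at hlt
    exact ⟨⟨h1, hn⟩, hx, h0, hlt⟩
  · rintro ⟨ha, hx, h0, hlt⟩
    refine ⟨ha.1, ha.2, ⟨hx, h0, hlt.trans_le (nodeBound_le_one β _)⟩, ?_⟩
    rwa [← nodeBound_eq_betaMap_iterate hβ hfin ha]

lemma exists_subtileIndex_mem_subIntAt : ∃ C : ℝ, ∀ u ∈ zInvNonneg β, ∃ p ∈ subtileIndex β,
    (p.2 : ℝ) = betaFract β u ∧ u ∈ subIntAt β p ∧ ‖phi β u - phi β p.2‖ ≤ C := by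
  have hβ := hP.out.one_lt
  have hfin := hasFiniteExpansion_one hP.out.isIntegral hF
  obtain ⟨C, hC⟩ := exists_norm_phi_subInt_le hF
  refine ⟨C, fun u hu => ?_⟩
  obtain ⟨a, ha, y, hy, huy, hlt⟩ := exists_subInt_add_betaFract hβ hfin hu.2
  obtain ⟨y', hy', rfl, hyC⟩ := hC a y hy
  have hx : ((u - y' : K β) : ℝ) = betaFract β u := by
    push_cast
    linarith
  refine ⟨(a, u - y'), (mem_subtileIndex hF).2 ⟨ha, sub_mem hu.1 hy', hx ▸ hlt⟩, hx, ?_, ?_⟩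
  · rwa [mem_subIntAt, sub_sub_cancel]
  · rwa [← map_sub, sub_sub_cancel]

lemma subIntAt_subset_zInvNonneg {p : ℕ × K β} (hx : p.2 ∈ tileIndex β) :
    subIntAt β p ⊆ zInvNonneg β := by
  intro u hu
  have hβ := hP.out.one_lt
  have hfin := hasFiniteExpansion_one hP.out.isIntegral hF
  have hy : u - p.2 ∈ zInvK β := subInt_subset_zInv hβ hfin hP.out.isIntegral _ hu
  have hy0 : 0 ≤ (u : ℝ) - p.2 := by exact_mod_cast subInt_nonneg hβ hu
  exact ⟨by simpa only [sub_add_cancel] using add_mem hy hx.1, by linarith [hx.2.1]⟩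

lemma betaFract_of_mem_subIntAt {p : ℕ × K β} (hp : p ∈ subtileIndex β) {u : K β}
    (hu : u ∈ subIntAt β p) : betaFract β u = p.2 := by
  have hfin := hasFiniteExpansion_one hP.out.isIntegral hF
  have h := betaFract_subInt_add hP.out.one_lt hfin hu ((mem_subtileIndex hF).1 hp).2.2
  push_cast at h
  rwa [sub_add_cancel] at h

lemma fractFiber_subset_zInvNonneg {x : K β} (hx : x ∈ tileIndex β) :
    fractFiber β x ⊆ zInvNonneg β := by
  rintro u ⟨h0, hux⟩
  have hβ := hP.out.one_lt
  have hfin := hasFiniteExpansion_one hP.out.isIntegral hF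
  obtain ⟨a, -, y, hy, huy, -⟩ := exists_subInt_add_betaFract hβ hfin h0
  refine ⟨mem_zInvK.2 ?_, h0⟩
  rw [huy, hux]
  exact add_mem (subInt_subset_zInv hβ hfin hP.out.isIntegral a hy) hx.1

lemma fractFiber_eq_iUnion_subIntAt {x : K β} (hx : x ∈ tileIndex β) :
    fractFiber β x = ⋃ a : {a // (a, x) ∈ subtileIndex β}, subIntAt β (a, x) := by
  ext u
  rw [Set.mem_iUnion]
  constructor
  · intro hu
    obtain ⟨C, hC⟩ := exists_subtileIndex_mem_subIntAt hF
    obtain ⟨⟨a, x'⟩, hp, hx', hup, -⟩ := hC u (fractFiber_subset_zInvNonneg hF hx hu)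
    obtain rfl : x' = x := Subtype.ext (hx'.trans hu.2)
    exact ⟨⟨a, hp⟩, hup⟩
  · rintro ⟨⟨a, ha⟩, hu⟩
    exact ⟨(subIntAt_subset_zInvNonneg hF hx hu).2, betaFract_of_mem_subIntAt hF ha hu⟩

/-- Near `0` the element `β⁻ᴸu` has bounded fractional part, which therefore has at most `L`
digits when `L` is large: `u` has no fractional part at all. -/
lemma exists_mem_subInt_of_norm_phi_lt :
    ∃ r > 0, ∀ u ∈ zInvNonneg β, ‖phi β u‖ < r → ∃ a, (u : ℝ) ∈ subInt β a := by
  have hβ := hP.out.one_lt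
  have hfin := hasFiniteExpansion_one hP.out.isIntegral hF
  obtain ⟨C, hC⟩ := exists_subtileIndex_mem_subIntAt hF
  obtain ⟨L, hL⟩ := exists_forall_digit_eq_zero hF (C + 1)
  obtain ⟨r, hr, hsmall⟩ := exists_norm_phi_mul_lt ((gen β)⁻¹ ^ L) one_pos
  refine ⟨r, hr, fun u hu hur => ?_⟩
  have hv := inv_gen_pow_mul_mem_zInvNonneg hu L
  obtain ⟨p, hp, hfract, -, hpC⟩ := hC _ hv
  have hpC' : ‖phi β p.2‖ ≤ C + 1 := by
    linarith [hsmall u hur, norm_le_norm_add_norm_sub (phi β ((gen β)⁻¹ ^ L * u)) (phi β p.2)]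
  rw [← coe_inv_gen_pow_mul L u]
  exact exists_mul_pow_mem_subInt hβ hfin hv.2 (hfract ▸ hL p.2 hp.2.2.1 hpC')

lemma isOpenIn_phi_subIntAt {p : ℕ × K β} (hx : p.2 ∈ tileIndex β) :
    IsOpenIn (phi β '' zInvNonneg β) (phi β '' subIntAt β p) := by
  have hβ := hP.out.one_lt
  have hfin := hasFiniteExpansion_one hP.out.isIntegral hF
  obtain ⟨r₁, hr₁, hnode⟩ := exists_mem_subInt_of_norm_phi_lt hF
  refine isOpenIn_iff_forall_mem.2 ⟨Set.image_mono (subIntAt_subset_zInvNonneg hF hx), ?_⟩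
  rintro _ ⟨v, hv, rfl⟩
  obtain ⟨k, hk⟩ := exists_forall_mul_pow_add_mem_subInt hβ hfin hv
  obtain ⟨r₂, hr₂, hle⟩ := exists_le_of_norm_phi_sub_lt β v
  obtain ⟨r₃, hr₃, hsmall⟩ := exists_norm_phi_mul_lt ((gen β)⁻¹ ^ k) hr₁
  refine ⟨Metric.ball (phi β v) (min r₂ r₃), Metric.isOpen_ball,
    Metric.mem_ball_self (by positivity), ?_⟩
  rintro _ ⟨hball, u, hu, rfl⟩
  rw [mem_ball_iff_norm, lt_min_iff] at hball
  have huv : u - v ∈ zInvNonneg β := by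
    refine ⟨sub_mem hu.1 (subIntAt_subset_zInvNonneg hF hx hv).1, ?_⟩
    push_cast
    exact sub_nonneg.2 (hle u hu hball.1)
  obtain ⟨b, hb⟩ := hnode _ (inv_gen_pow_mul_mem_zInvNonneg huv k)
    (hsmall _ (by rw [map_sub]; exact hball.2))
  have key := hk b _ hb
  rw [coe_inv_gen_pow_mul] at key
  refine ⟨u, ?_, rfl⟩
  rw [mem_subIntAt]
  convert key using 1
  push_cast
  ring

end Finiteness

/-! ### Tiles -/

section Tiles

open scoped Pointwise

variable {β : ℝ} [hP : Fact (IsPisot β)]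

lemma subtileAt_eq_closure (p : ℕ × K β) :
    subtileAt β p.1 p.2 = closure (phi β '' subIntAt β p) := by
  have himage : phi β '' subIntAt β p =
      (· + phi β p.2) '' (phi β '' {y : K β | (y : ℝ) ∈ subInt β p.1}) := by
    ext z
    simp only [Set.mem_image, exists_exists_and_eq_and]
    constructor
    · rintro ⟨u, hu, rfl⟩
      exact ⟨u - p.2, hu, by rw [← map_add, sub_add_cancel]⟩
    · rintro ⟨y, hy, rfl⟩
      exact ⟨y + p.2, by rwa [mem_subIntAt, add_sub_cancel_right], map_add ..⟩
  rw [himage]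
  exact (Homeomorph.addRight (phi β p.2)).image_closure _

lemma measure_frontier_subtileAt_eq (μ : Measure (KBeta β)) [μ.IsAddRightInvariant] (a : ℕ)
    (x : K β) : μ (frontier (subtileAt β a x)) = μ (frontier (subtile β a)) := by
  change μ (frontier (Homeomorph.addRight (phi β x) '' subtile β a)) = _
  rw [← (Homeomorph.addRight (phi β x)).image_frontier]
  simp only [Homeomorph.coe_addRight, Set.image_add_right, measure_preimage_add_right]

lemma zero_mem_tileIndex (β : ℝ) : (0 : K β) ∈ tileIndex β :=
  ⟨zero_mem (zInvK β), by simp, by simp⟩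

variable (hF : FinitenessProperty β)
include hF

lemma isOpenIn_phi_fractFiber {x : K β} (hx : x ∈ tileIndex β) :
    IsOpenIn (phi β '' zInvNonneg β) (phi β '' fractFiber β x) := by
  rw [fractFiber_eq_iUnion_subIntAt hF hx, Set.image_iUnion]
  exact .iUnion fun _ => isOpenIn_phi_subIntAt hF hx

lemma pairwiseDisjoint_subIntAt : (subtileIndex β).PairwiseDisjoint (subIntAt β) := by
  intro p hp q hq hne
  refine Set.disjoint_left.2 fun u hu hu' => hne ?_
  have hfin := hasFiniteExpansion_one hP.out.isIntegral hF
  obtain ⟨ha, hx⟩ := subInt_add_unique hP.out.one_lt hfin hu hu'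
    ((mem_subtileIndex hF).1 hp).2.2 ((mem_subtileIndex hF).1 hq).2.2 (by push_cast; ring)
  exact Prod.ext ha (Subtype.ext hx)

lemma pairwiseDisjoint_subIntAt_prodMk (a : ℕ) :
    (tileIndex β).PairwiseDisjoint fun x => subIntAt β (a, x) := by
  intro x hx x' hx' hne
  refine Set.disjoint_left.2 fun u hu hu' => hne (Subtype.ext ?_)
  have hfin := hasFiniteExpansion_one hP.out.isIntegral hF
  exact subInt_translate_unique hP.out.one_lt hfin hu hu' hx.2 hx'.2 (by push_cast; ring)

lemma exists_forall_gen_mul_mem_subIntAt {p : ℕ × K β} (hp : p ∈ subtileIndex β) :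
    ∃ q ∈ subtileIndex β, ∀ u ∈ subIntAt β p, gen β * u ∈ subIntAt β q := by
  have hβ := hP.out.one_lt
  have hfin := hasFiniteExpansion_one hP.out.isIntegral hF
  obtain ⟨hp1, hp2, hp3⟩ := (mem_subtileIndex hF).1 hp
  obtain ⟨a, ha, hlt, hmul⟩ := exists_mul_subInt_add_eq hβ hfin hp1 hp3
  have hx : ((gen β * p.2 - (⌊β * p.2⌋ : ℤ) : K β) : ℝ) = betaMap β p.2 := by
    push_cast
    rw [coe_gen]
    rfl
  refine ⟨(a, gen β * p.2 - (⌊β * p.2⌋ : ℤ)), (mem_subtileIndex hF).2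
    ⟨ha, sub_mem (mul_mem (gen_mem_zInvK β) hp2) (intCast_mem _ _), ?_⟩, fun u hu => ?_⟩
  · rw [hx]
    exact ⟨(betaMap_mem_Ico β _).1, hlt⟩
  · obtain ⟨y', hy', h⟩ := hmul _ hu
    rw [mem_subIntAt]
    convert hy' using 1
    push_cast at h hx ⊢
    rw [hx, coe_gen]
    linarith

omit hF in
variable (β) in
/-- The points that are inner to no member of the family of all translated subtiles. -/
def exceptionalSet : Set (KBeta β) := (⋃ p ∈ subtileIndex β, interior (subtileAt β p.1 p.2))ᶜ

variable (β) in
/-- Multiplication by `φ_β(β)` as a unit. -/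
def phiGenUnit : (KBeta β)ˣ :=
  Units.map (phi β : K β →* KBeta β) (Units.mk0 (gen β) (gen_ne_zero β))

lemma mem_exceptionalSet_of_smul_mem {z : KBeta β}
    (hz : phiGenUnit β • z ∈ exceptionalSet β) : z ∈ exceptionalSet β := by
  contrapose! hz
  simp only [exceptionalSet, Set.mem_compl_iff, Set.mem_iUnion₂, not_not] at hz ⊢
  obtain ⟨p, hp, hzp⟩ := hz
  obtain ⟨q, hq, hpq⟩ := exists_forall_gen_mul_mem_subIntAt hF hp
  refine ⟨q, hq, interior_maximal ?_ (isOpen_interior.smul (phiGenUnit β))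
    (Set.smul_mem_smul_set hzp)⟩
  calc phiGenUnit β • interior (subtileAt β p.1 p.2)
      ⊆ phiGenUnit β • closure (phi β '' subIntAt β p) := by
        rw [← subtileAt_eq_closure]
        exact Set.smul_set_mono interior_subset
    _ ⊆ closure (phiGenUnit β • phi β '' subIntAt β p) := (closure_smul _ _).ge
    _ ⊆ subtileAt β q.1 q.2 := by
        rw [subtileAt_eq_closure]
        refine closure_mono ?_
        rintro _ ⟨_, ⟨u, hu, rfl⟩, rfl⟩
        exact ⟨gen β * u, hpq u hu, map_mul ..⟩

section Measure

attribute [local instance] fintypePrimesOver fintypePlaces normedCommRing properSpace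

lemma exists_ball_subset_subtileAt_one :
    ∃ ρ > 0, ∀ x : K β, Metric.ball (phi β x) ρ ⊆ subtileAt β 1 x := by
  have hfin := hasFiniteExpansion_one hP.out.isIntegral hF
  have hmem : (0 : K β) ∈ subIntAt β (1, 0) := by
    simpa [mem_subIntAt] using zero_mem_subInt_one hP.out.one_lt hfin
  have hsub : subIntAt β (1, 0) ⊆ {y | (y : ℝ) ∈ subInt β 1} := fun y hy => by
    rwa [mem_subIntAt, sub_zero] at hy
  have hopen := isOpenIn_phi_subIntAt hF (p := (1, (0 : K β))) (zero_mem_tileIndex β)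
  have hint := hopen.subset_interior_closure (dense_phi_zInvNonneg β) ⟨0, hmem, map_zero _⟩
  obtain ⟨ρ, hρ, hball⟩ := Metric.mem_nhds_iff.1 (mem_interior_iff_mem_nhds.1 hint)
  refine ⟨ρ, hρ, fun x w hw => ⟨w - phi β x, closure_mono (Set.image_mono hsub) (hball ?_),
    sub_add_cancel _ _⟩⟩
  rwa [mem_ball_zero_iff, ← mem_ball_iff_norm]

lemma exists_dist_le_disjoint_exceptionalSet : ∃ ρ > 0, ∃ C : ℝ, ∀ w : KBeta β,
    ∃ z, dist w z ≤ C ∧ Disjoint (Metric.ball z ρ) (exceptionalSet β) := by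
  have hβ := hP.out.one_lt
  have hfin := hasFiniteExpansion_one hP.out.isIntegral hF
  obtain ⟨ρ, hρ, hball⟩ := exists_ball_subset_subtileAt_one hF
  obtain ⟨C, hC⟩ := exists_subtileIndex_mem_subIntAt hF
  refine ⟨ρ, hρ, 1 + C, fun w => ?_⟩
  obtain ⟨_, ⟨u, hu, rfl⟩, hwu⟩ := (dense_phi_zInvNonneg β).exists_dist_lt w one_pos
  obtain ⟨p, hp, -, -, hpC⟩ := hC u hu
  have hp1 : (1, p.2) ∈ subtileIndex β := (mem_subtileIndex hF).2
    ⟨⟨le_rfl, nodeCount_pos hβ hfin⟩, hp.2.2.1.1, by rw [nodeBound_one]; exact hp.2.2.1.2⟩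
  refine ⟨phi β p.2, ?_, ?_⟩
  · rw [← dist_eq_norm] at hpC
    exact (dist_triangle ..).trans (add_le_add hwu.le hpC)
  · refine Set.disjoint_left.2 fun z hz hzN => hzN (Set.mem_biUnion hp1 ?_)
    exact interior_maximal (hball _) Metric.isOpen_ball hz

lemma measure_exceptionalSet (μ : Measure (KBeta β)) [μ.IsAddHaarMeasure] :
    μ (exceptionalSet β) = 0 := by
  obtain ⟨ρ, hρ, C, hole⟩ := exists_dist_le_disjoint_exceptionalSet hF
  have hclosed : IsClosed (exceptionalSet β) :=
    (isOpen_biUnion fun _ _ => isOpen_interior).isClosed_compl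
  refine measure_eq_zero_of_porous (E := KBeta β) (b := phiGenUnit β) ?_ hclosed ?_ hρ hole
  · exact norm_phi_gen_lt_one β
  · intro z hz
    exact mem_exceptionalSet_of_smul_mem hF hz

end Measure

lemma frontier_subset_exceptionalSet {A : Set (K β)}
    (hA : IsOpenIn (phi β '' zInvNonneg β) (phi β '' A))
    (h : ∀ p ∈ subtileIndex β, subIntAt β p ⊆ A ∨ Disjoint A (subIntAt β p)) :
    frontier (closure (phi β '' A)) ⊆ exceptionalSet β := by
  simp only [exceptionalSet, subtileAt_eq_closure]
  refine hA.frontier_closure_subset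
    (fun p hp => Set.image_mono (subIntAt_subset_zInvNonneg hF hp.2.2.1)) fun p hp => ?_
  exact (h p hp).imp (fun h => Set.image_mono h) (Set.disjoint_image_iff (phi_injective β)).2

variable (μ : Measure (KBeta β)) [μ.IsAddHaarMeasure]

lemma measure_frontier_tile {x : K β} (hx : x ∈ tileIndex β) : μ (frontier (tile β x)) = 0 := by
  refine measure_mono_null (frontier_subset_exceptionalSet hF (isOpenIn_phi_fractFiber hF hx)
    fun p hp => ?_) (measure_exceptionalSet hF μ)
  by_cases hpx : p.2 = x
  · left
    subst hpx
    exact fun u hu => ⟨(subIntAt_subset_zInvNonneg hF hx hu).2, betaFract_of_mem_subIntAt hF hp hu⟩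
  · right
    exact Set.disjoint_left.2 fun u hux hup =>
      hpx (Subtype.ext ((betaFract_of_mem_subIntAt hF hp hup).symm.trans hux.2))

lemma measure_frontier_subtileAt_of_mem {p : ℕ × K β} (hp : p ∈ subtileIndex β) :
    μ (frontier (subtileAt β p.1 p.2)) = 0 := by
  rw [subtileAt_eq_closure]
  refine measure_mono_null (frontier_subset_exceptionalSet hF
    (isOpenIn_phi_subIntAt hF hp.2.2.1) fun q hq => ?_) (measure_exceptionalSet hF μ)
  obtain rfl | hne := eq_or_ne p q
  · exact .inl subset_rfl
  · exact .inr (pairwiseDisjoint_subIntAt hF hp hq hne)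

lemma measure_frontier_subtileAt {a : ℕ} (ha : a ∈ Set.Icc 1 (nodeCount β)) (x : K β) :
    μ (frontier (subtileAt β a x)) = 0 := by
  have h0 : (a, (0 : K β)) ∈ subtileIndex β := (mem_subtileIndex hF).2
    ⟨ha, zero_mem _, by simpa using nodeBound_pos β a⟩
  simpa only [measure_frontier_subtileAt_eq] using measure_frontier_subtileAt_of_mem hF μ h0

omit hF [μ.IsAddHaarMeasure] in
lemma isPacking_closure_phi {ι : Type*} {I : Set ι} {A : ι → Set (K β)}
    (hA : ∀ i ∈ I, IsOpenIn (phi β '' zInvNonneg β) (phi β '' A i)) (hdisj : I.PairwiseDisjoint A)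
    (hμ : ∀ i ∈ I, μ (frontier (closure (phi β '' A i))) = 0) :
    IsPacking μ I fun i => closure (phi β '' A i) :=
  isPacking_closure (dense_phi_zInvNonneg β) hA
    (fun _ hi _ hj hij => (Set.disjoint_image_iff (phi_injective β)).2 (hdisj hi hj hij)) hμ

lemma isPacking_tile : IsPacking μ (tileIndex β) (tile β) :=
  isPacking_closure_phi μ (fun _ => isOpenIn_phi_fractFiber hF)
    (fun _ _ _ _ hne => Set.disjoint_left.2 fun _ hu hu' =>
      hne (Subtype.ext (hu.2.symm.trans hu'.2)))
    fun _ => measure_frontier_tile hF μ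

lemma isPacking_subtileAt {a : ℕ} (ha : a ∈ Set.Icc 1 (nodeCount β)) :
    IsPacking μ (tileIndex β) (subtileAt β a) := by
  have hclosure : subtileAt β a = fun x => closure (phi β '' subIntAt β (a, x)) :=
    funext fun x => subtileAt_eq_closure (a, x)
  have hμ := fun x (_ : x ∈ tileIndex β) => measure_frontier_subtileAt hF μ ha x
  rw [hclosure] at hμ ⊢
  exact isPacking_closure_phi μ (fun x => isOpenIn_phi_subIntAt hF (p := (a, x)))
    (pairwiseDisjoint_subIntAt_prodMk hF a) hμ

lemma isPacking_subtileIndex :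
    IsPacking μ (subtileIndex β) fun p => subtileAt β p.1 p.2 := by
  have hμ := fun p (hp : p ∈ subtileIndex β) => measure_frontier_subtileAt_of_mem hF μ hp
  simp only [subtileAt_eq_closure] at hμ ⊢
  exact isPacking_closure_phi μ (fun _ hp => isOpenIn_phi_subIntAt hF hp.2.2.1)
    (pairwiseDisjoint_subIntAt hF) hμ

end Tiles

end BetaTile

end

open BetaTile in
theorem mainTheorem3 (β : ℝ) [Fact (IsPisot β)] (hF : FinitenessProperty β)
    (μ : Measure (KBeta β)) [μ.IsAddHaarMeasure] :
    -- the complete `x`-tiles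
    ((∀ x ∈ tileIndex β,
        tile β x = closure (interior (tile β x)) ∧
        (∀ z ∈ interior (tile β x), IsExclusive (tileIndex β) (tile β) x z) ∧
        μ (frontier (tile β x)) = 0) ∧
      (∀ x ∈ tileIndex β, ∀ x' ∈ tileIndex β, x ≠ x' →
        Disjoint (tile β x') (interior (tile β x)) ∧
        μ (tile β x ∩ tile β x') = 0)) ∧
    -- for each node `a`, the translates of the complete central `a`-subtile
    (∀ a : ℕ, 1 ≤ a → a ≤ nodeCount β →
      (∀ x ∈ tileIndex β,
        subtileAt β a x = closure (interior (subtileAt β a x)) ∧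
        (∀ z ∈ interior (subtileAt β a x), IsExclusive (tileIndex β) (subtileAt β a) x z) ∧
        μ (frontier (subtileAt β a x)) = 0) ∧
      (∀ x ∈ tileIndex β, ∀ x' ∈ tileIndex β, x ≠ x' →
        Disjoint (subtileAt β a x') (interior (subtileAt β a x)) ∧
        μ (subtileAt β a x ∩ subtileAt β a x') = 0)) ∧
    -- the family of all translated subtiles, of all nodes, into which the `x`-tiles decompose
    ((∀ p ∈ subtileIndex β, ∀ z ∈ interior (subtileAt β p.1 p.2),
        IsExclusive (subtileIndex β) (fun q => subtileAt β q.1 q.2) p z) ∧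
      (∀ p ∈ subtileIndex β, ∀ q ∈ subtileIndex β, p ≠ q →
        Disjoint (subtileAt β q.1 q.2) (interior (subtileAt β p.1 p.2)) ∧
        μ (subtileAt β p.1 p.2 ∩ subtileAt β q.1 q.2) = 0)) := by
  have hsub := isPacking_subtileIndex hF μ
  exact ⟨isPacking_tile hF μ, fun a h1 hn => isPacking_subtileAt hF μ ⟨h1, hn⟩,
    fun p hp => (hsub.1 p hp).2.1, hsub.2⟩
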